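/- Conventions. All logarithms are to base two. PPT means (uniform) probabilistic polynomial time, where the running time is bounded by a polynomial in $n$ for all inputs and all coin tosses. A function family $f=\{f_n:\{0,1\}^n\to\{0,1\}^n\}_{n\in\mathbb N}$ is one-way if it is computable in deterministic polynomial time and, for every PPT algorithm $B$, the probability $\Pr[f(B(f(X)))=f(X)]$, over $X$ uniform on $\{0,1\}^n$ and the coins of $B$, is negligible, i.e. $n^{-\omega(1)}$. (An output of $B$ outside $\{0,1\}^n$ counts as a failure.) For $n\ge 1$ define $F=F_n$ on $\{0,1\}^n\times[n]$ by $F(x,i)=f(x)_{1,\dots,i-1}$, the string of the first $i-1$ bits of $f(x)$, and let $Z=(X,I)$ be uniformly distributed on $\{0,1\}^n\times[n]$. For random variables $U,V$, the conditional Shannon entropy is $H(U\mid V)=\mathbb E_{(u,v)\leftarrow(U,V)}[\log(1/\Pr[U=u\mid V=v])]$. An $F$-collision finder is a randomized map $A$ from $\{0,1\}^n\times[n]$ to itself such that, on every input $z$ and for all outcomes of its randomness, $A(z)\in F^{-1}(F(z))$. Theorem. (1) If $f$ is one-way, then $F^{-1}$ has accessible Shannon entropy at most $H(Z\mid F(Z))-\frac1{64n^2}$.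 That is, for every PPT $F$-collision finder $A$ we have $$H(A(Z)\mid Z)\le H(Z\mid F(Z))-\frac1{64n^2}$$ for all sufficiently large $n$. (2) Let $f=\{f_n:\{0,1\}^n\to\{0,1\}^n\}$ be computable in deterministic polynomial time. Then there is a PPT oracle algorithm $\mathrm{Inv}$ such that the following holds for every $n\ge1$ and every (not necessarily efficient) $F_n$-collision finder $A$. Given any $y\in\{0,1\}^n$ and oracle access to $A$, where each query is answered with fresh randomness, $\mathrm{Inv}^A(y)$ halts in time polynomial in $n$ (one polynomial for all $n$, $A$ and $y$) and makes at most $8n$ oracle queries. If moreover $$H(A(Z)\mid Z)\ge H(Z\mid F(Z))-\frac1{64n^2},$$ then $\Pr[f(\mathrm{Inv}^A(f(X)))=f(X)]\ge\frac14$, where $X$ is uniform on $\{0,1\}^n$. -/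

import Mathlib

open Filter

noncomputable section

namespace InaccessibleEntropy

/-! ### Machine model: probabilistic stack programs with an optional oracle, and their step count -/

/-- Binary words. -/
abbrev Word := List Bool

/-- Programs. A program works on registers numbered by the natural numbers (each program mentions
finitely many of them), each of which holds a binary word. As in a list-processing or multi-stack
machine, every elementary command costs one step. Since one step lengthens the longest register by
at most one letter (oracle answers excepted), polynomial time in this model is the same as
polynomial time on multi-tape Turing machines. -/
inductive Cmd : Type
  /-- Do nothing. -/
  | skip : Cmd
  /-- `clear r`: let register `r` hold the empty word. -/
  | clear (r : ℕ) : Cmd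
  /-- `copy r s`: let register `r` hold the word in register `s`. -/
  | copy (r s : ℕ) : Cmd
  /-- `push r b`: put the bit `b` in front of the word in register `r`. -/
  | push (r : ℕ) (b : Bool) : Cmd
  /-- `pop r`: delete the first bit of register `r`, if there is one. -/
  | pop (r : ℕ) : Cmd
  /-- `flip r`: toss a fair coin and put it in front of the word in register `r`. -/
  | flip (r : ℕ) : Cmd
  /-- `query r s`: ask the oracle about the pair of words in registers `r` and `s`,
  and replace these two words by the pair that it answers. -/
  | query (r s : ℕ) : Cmd
  /-- `seq c d`: run `c`, then `d`. -/
  | seq (c d : Cmd) : Cmd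
  /-- `cases r e c₀ c₁`: run `e`, `c₀` or `c₁` according to whether register `r` is empty,
  starts with `false`, or starts with `true`. -/
  | cases (r : ℕ) (e c₀ c₁ : Cmd) : Cmd
  /-- `loop r c`: as long as register `r` is not empty, run `c`. -/
  | loop (r : ℕ) (c : Cmd) : Cmd

/-- The program never queries the oracle. -/
def Cmd.OracleFree : Cmd → Prop
  | .query _ _ => False
  | .seq c d => c.OracleFree ∧ d.OracleFree
  | .cases _ e c d => e.OracleFree ∧ c.OracleFree ∧ d.OracleFree
  | .loop _ c => c.OracleFree
  | _ => True

/-- The program never tosses a coin. -/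
def Cmd.CoinFree : Cmd → Prop
  | .flip _ => False
  | .seq c d => c.CoinFree ∧ d.CoinFree
  | .cases _ e c d => e.CoinFree ∧ c.CoinFree ∧ d.CoinFree
  | .loop _ c => c.CoinFree
  | _ => True

/-- A configuration: the commands still to be run, the contents of the registers,
and the number of oracle queries made so far. -/
structure Config : Type where
  cont : List Cmd
  store : ℕ → Word
  queries : ℕ

/-- A randomized oracle, answering pairs of words by pairs of words.
Each query is answered with fresh, independent randomness. -/
abbrev Oracle := Word × Word → PMF (Word × Word)

/-- One step of the machine with oracle `O`. A configuration with no command left has halted. -/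
def step (O : Oracle) : Config → PMF Config
  | ⟨[], s, q⟩ => PMF.pure ⟨[], s, q⟩
  | ⟨.skip :: k, s, q⟩ => PMF.pure ⟨k, s, q⟩
  | ⟨.clear r :: k, s, q⟩ => PMF.pure ⟨k, Function.update s r [], q⟩
  | ⟨.copy r t :: k, s, q⟩ => PMF.pure ⟨k, Function.update s r (s t), q⟩
  | ⟨.push r b :: k, s, q⟩ => PMF.pure ⟨k, Function.update s r (b :: s r), q⟩
  | ⟨.pop r :: k, s, q⟩ => PMF.pure ⟨k, Function.update s r (s r).tail, q⟩
  | ⟨.flip r :: k, s, q⟩ =>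
      (PMF.uniformOfFintype Bool).map fun b => ⟨k, Function.update s r (b :: s r), q⟩
  | ⟨.query r t :: k, s, q⟩ =>
      (O (s r, s t)).map fun a => ⟨k, Function.update (Function.update s r a.1) t a.2, q + 1⟩
  | ⟨.seq c d :: k, s, q⟩ => PMF.pure ⟨c :: d :: k, s, q⟩
  | ⟨.cases r e c d :: k, s, q⟩ =>
      PMF.pure ⟨(match s r with | [] => e | false :: _ => c | true :: _ => d) :: k, s, q⟩
  | ⟨.loop r c :: k, s, q⟩ =>
      PMF.pure ⟨match s r with | [] => k | _ :: _ => c :: .loop r c :: k, s, q⟩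

/-- The distribution of the configuration after `t` steps. -/
def run (O : Oracle) : ℕ → Config → PMF Config
  | 0, σ => PMF.pure σ
  | t + 1, σ => (step O σ).bind (run O t)

/-- The program `c` started on the input `w`: the two components of the input are in
registers `0` and `1`, and all other registers are empty. -/
def start (c : Cmd) (w : Word × Word) : Config :=
  ⟨[c], fun r => if r = 0 then w.1 else if r = 1 then w.2 else [], 0⟩

/-- With oracle `O`, the program `c` on input `w` halts within `t` steps,
whatever the coin tosses and the oracle's answers. -/
def HaltsIn (O : Oracle) (c : Cmd) (w : Word × Word) (t : ℕ) : Prop :=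
  ∀ σ ∈ (run O t (start c w)).support, σ.cont = []

/-- With oracle `O`, the program `c` on input `w` makes at most `m` queries in its first `t` steps,
whatever the coin tosses and the oracle's answers. -/
def QueriesAtMost (O : Oracle) (c : Cmd) (w : Word × Word) (t m : ℕ) : Prop :=
  ∀ σ ∈ (run O t (start c w)).support, σ.queries ≤ m

/-- The distribution of the contents of the registers `0` and `1` after `t` steps
of the program `c` on input `w`. If the program halts within `t` steps, this is its output. -/
def output (O : Oracle) (c : Cmd) (w : Word × Word) (t : ℕ) : PMF (Word × Word) :=
  (run O t (start c w)).map fun σ => (σ.store 0, σ.store 1)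

/-- A dummy oracle, for programs that make no queries. -/
def noOracle : Oracle := fun _ => PMF.pure ([], [])

/-! ### One-way functions -/

/-- The set `{0,1}^n`. -/
abbrev Bits (n : ℕ) := Fin n → Bool

/-- `x ∈ {0,1}^n` as an input of a program. -/
def encodeBits {n : ℕ} (x : Bits n) : Word × Word := (List.ofFn x, [])

/-- The length-preserving function `f`, given as a family `f n : {0,1}^n → {0,1}^n`, is computable
in deterministic polynomial time. -/
def PolyTimeComputable (f : ∀ n, Bits n → Bits n) : Prop :=
  ∃ (c : Cmd) (p : Polynomial ℕ), c.OracleFree ∧ c.CoinFree ∧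
    ∀ n (x : Bits n), HaltsIn noOracle c (encodeBits x) (p.eval n) ∧
      (output noOracle c (encodeBits x) (p.eval n)).map Prod.fst = PMF.pure (List.ofFn (f n x))

/-- The probability, over a uniform `x ∈ {0,1}^n` and the randomness of the inverter `B`,
that `B (f x)` is (the word of) a preimage of `f x` in `{0,1}^n`. -/
def inversionProb {n : ℕ} (f : Bits n → Bits n) (B : Bits n → PMF Word) : ℝ :=
  (((PMF.uniformOfFintype (Bits n)).bind fun x => (B (f x)).map fun w => (x, w)).toOuterMeasure
    {q | ∃ x' : Bits n, q.2 = List.ofFn x' ∧ f x' = f q.1}).toReal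

/-- `f` is a one-way function: it is computable in polynomial time, and every probabilistic
polynomial-time algorithm inverts it with negligible probability only. (The algorithm knows the
security parameter `n`, which is the length of its input.) -/
def IsOneWay (f : ∀ n, Bits n → Bits n) : Prop :=
  PolyTimeComputable f ∧
  ∀ (c : Cmd) (p : Polynomial ℕ), c.OracleFree →
    (∀ n (y : Bits n), HaltsIn noOracle c (encodeBits y) (p.eval n)) →
    Asymptotics.SuperpolynomialDecay atTop (fun n : ℕ => (n : ℝ)) fun n =>
      inversionProb (f n) fun y => (output noOracle c (encodeBits y) (p.eval n)).map Prod.fst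

/-! ### Entropy, and accessible entropy -/

/-- Conditional Shannon entropy `H(X | Y)`, in bits, of two random variables on a finite probability
space: the expectation of `log₂ (1 / Pr[X = x | Y = y])` over `(x, y)` drawn from `(X, Y)`. -/
def condEntropy {Ω α β : Type} [Fintype Ω] (P : PMF Ω) (X : Ω → α) (Y : Ω → β) : ℝ :=
  ∑ ω, (P ω).toReal *
    Real.logb 2 ((P.map Y (Y ω)).toReal / (P.map (fun ω' => (X ω', Y ω')) (X ω, Y ω)).toReal)

/-- The set `{0,1}^n × [n]`. The index `i ∈ [n] = {1, …, n}` is represented by `i - 1 : Fin n`. -/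
abbrev Dom (n : ℕ) := Bits n × Fin n

/-- `(x, i) ∈ {0,1}^n × [n]` as an input of a program, with `i` written in unary. -/
def encode {n : ℕ} (z : Dom n) : Word × Word :=
  (List.ofFn z.1, List.replicate (z.2.val + 1) true)

theorem encode_injective (n : ℕ) : Function.Injective (encode : Dom n → Word × Word) := by
  rintro ⟨x, i⟩ ⟨y, j⟩ h
  simp only [encode, Prod.mk.injEq] at h
  have h2 := congrArg List.length h.2
  rw [List.length_replicate, List.length_replicate] at h2
  exact Prod.ext (List.ofFn_injective h.1) (Fin.ext (Nat.succ.inj h2))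

/-- A randomized map on `{0,1}^n × [n]`, for every `n`: the input-output behaviour
of a randomized algorithm. -/
abbrev RandMap := ∀ n, Dom n → PMF (Dom n)

/-- `A` is computed by a probabilistic polynomial-time algorithm. -/
def IsPPT (A : RandMap) : Prop :=
  ∃ (c : Cmd) (p : Polynomial ℕ), c.OracleFree ∧
    ∀ n (z : Dom n), HaltsIn noOracle c (encode z) (p.eval n) ∧
      output noOracle c (encode z) (p.eval n) = (A n z).map encode

/-- `A` is a collision finder for `F`: it always produces an element of `F⁻¹(F(z))`. -/
def IsCollisionFinder {n : ℕ} {R : Type} (F : Dom n → R) (A : Dom n → PMF (Dom n)) : Prop :=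
  ∀ z, ∀ z' ∈ (A z).support, F z' = F z

/-- The real Shannon entropy `H(Z | F(Z))` of `F⁻¹`, for `Z` uniform on `{0,1}^n × [n]`. -/
def realEntropy {n : ℕ} [NeZero n] {R : Type} (F : Dom n → R) : ℝ :=
  condEntropy (PMF.uniformOfFintype (Dom n)) id F

/-- `H(A(Z) | Z)`, for `Z` uniform on `{0,1}^n × [n]`. -/
def outputEntropy {n : ℕ} [NeZero n] (A : Dom n → PMF (Dom n)) : ℝ :=
  condEntropy ((PMF.uniformOfFintype (Dom n)).bind fun z => (A z).map fun z' => (z, z'))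
    Prod.snd Prod.fst

/-- `F⁻¹` has accessible Shannon entropy at most `k(n)`: every probabilistic polynomial-time
collision finder `A` for `F` has `H(A(Z) | Z) ≤ k(n)` for all sufficiently large `n`. -/
def AccessibleEntropyAtMost {R : ℕ → Type} (F : ∀ n, Dom n → R n)
    (k : ∀ n : ℕ, [NeZero n] → ℝ) : Prop :=
  ∀ A : RandMap, IsPPT A → (∀ n, IsCollisionFinder (F n) (A n)) →
    ∀ᶠ n : ℕ in atTop, ∀ [NeZero n], outputEntropy (A n) ≤ k n

/-- The function `F(x, i) = f(x)_{1, …, i-1}` on `{0,1}^n × [n]`. -/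
def trim (f : ∀ n, Bits n → Bits n) (n : ℕ) (z : Dom n) : Word :=
  (List.ofFn (f n z.1)).take z.2.val

open Classical in
/-- The oracle that answers a query `z ∈ {0,1}^n × [n]` by a sample of `A z`
(and anything else by a pair of empty words). -/
def oracleOf {n : ℕ} (A : Dom n → PMF (Dom n)) : Oracle := fun w =>
  if h : ∃ z, encode z = w then (A h.choose).map encode else PMF.pure ([], [])

theorem oracleOf_encode {n : ℕ} (A : Dom n → PMF (Dom n)) (z : Dom n) :
    oracleOf A (encode z) = (A z).map encode := by
  have h : ∃ z', encode z' = encode z := ⟨z, rfl⟩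
  rw [oracleOf, dif_pos h, encode_injective n h.choose_spec]

end InaccessibleEntropy

end

/-! The inverter is a walk. From a uniform `x`, let `j` be the number of leading bits in which `f x`
agrees with the target `y`; query the finder at `x` and level `j`, and move to its answer, whose
image again agrees with `y` in those `j` bits. This is done `8 n` times, a preimage being kept once
found.

Let `S j` be the set of points whose image agrees with `y` in the first `j` bits, `V t x` the
probability that `t` steps from `x` fail, and `W t j` the average of `V t` over `S j`. For a finder
that is exactly uniform on its fibres, `V (t+1) x = W t j` on `S j \ S (j+1)`. With the potential `Φ
t`, the sum over `j` and over `x ∈ S j \ S (j+1)` of `V t x / |S (j+1)|`, this telescopes to `W t 0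
= Φ t - Φ (t+1)`. Since `W t 0` decreases in `t`, it follows that `T * W T 0 ≤ Φ 0`
(`sum_le_of_averaging`). For a target `f x₀`, summed over `x₀`, each pair `(x, j)` contributes at
most `1` to `Φ 0`: the targets that leave `x` exactly at level `j` share their first `j + 1` bits,
because bits are binary (`sum_levels_le`). So the average of `Φ 0` is at most `n`.

For a general finder, `deficit` is the relative entropy, in nats, between its answer and the uniform
distribution on the fibre. The variational bound `sum_mul_le_average_add` adds at most `c * deficit
+ 1 / c` to the step rule. This error is linear in the deficit, so the same count bounds its total
by the average deficit, which the entropy hypothesis controls. With `c = T = 8 n` the failure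
probability is at most `3/8` (`one_fourth_le_inversionProb`).

The rest realizes the walk as a program with a replaceable subprogram `ask`: an oracle query for the
reduction, the code of an efficient finder for the statement on one-way functions. -/

noncomputable section

namespace InaccessibleEntropy

/-! ### Reasoning about programs: values, time and queries -/

section ProgramLogic

/-! ### A program logic -/

/-- The contents of all registers. -/
abbrev Store := ℕ → Word

/-- From the store `s`, the commands `K` run for at most `T` steps and make at most `m` queries;
they compute a random value with distribution `D`, and the final store is related to this
value by `R`. -/
def Spec (O : Oracle) (K : List Cmd) (s : Store) (T m : ℕ) {α : Type} (D : PMF α)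
    (R : α → Store → Prop) : Prop :=
  ∃ μ : PMF (α × Store × ℕ × ℕ), μ.map Prod.fst = D ∧
    (∀ o ∈ μ.support, R o.1 o.2.1 ∧ o.2.2.1 ≤ T ∧ o.2.2.2 ≤ m) ∧
    ∀ k q t, T ≤ t → run O t ⟨K ++ k, s, q⟩ =
      μ.bind fun o => run O (t - o.2.2.1) ⟨k, o.2.1, q + o.2.2.2⟩

variable {O : Oracle} {K : List Cmd} {s : Store} {T m : ℕ} {α β γ : Type} {D : PMF α}
  {R : α → Store → Prop}

theorem bind_congr_support (p : PMF α) {f g : α → PMF β} (h : ∀ a ∈ p.support, f a = g a) :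
    p.bind f = p.bind g := by
  ext b
  simp only [PMF.bind_apply]
  refine tsum_congr fun a => ?_
  by_cases ha : a ∈ p.support
  · rw [h a ha]
  · rw [PMF.mem_support_iff, not_not] at ha
    simp [ha]

theorem run_halted (O : Oracle) (s : Store) (q t : ℕ) :
    run O t ⟨[], s, q⟩ = PMF.pure ⟨[], s, q⟩ := by
  induction t with
  | zero => rfl
  | succ t ih => simp [run, step, ih]

theorem Spec.nil {a : α} (h : R a s) : Spec O [] s 0 0 (PMF.pure a) R :=
  ⟨PMF.pure (a, s, 0, 0), by simp [PMF.pure_map], by simp [h], by simp⟩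

theorem Spec.mono {T' m' : ℕ} {R' : α → Store → Prop} (h : Spec O K s T m D R) (hT : T ≤ T')
    (hm : m ≤ m') (hR : ∀ a ∈ D.support, ∀ s', R a s' → R' a s') : Spec O K s T' m' D R' := by
  obtain ⟨μ, rfl, h2, h3⟩ := h
  refine ⟨μ, rfl, fun o ho => ?_, fun k q t ht => h3 k q t (hT.trans ht)⟩
  obtain ⟨a, b, c⟩ := h2 o ho
  exact ⟨hR _ (by rw [PMF.support_map]; exact ⟨o, ho, rfl⟩) _ a, b.trans hT, c.trans hm⟩

theorem Spec.map (h : Spec O K s T m D R) (g : α → β) :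
    Spec O K s T m (D.map g) fun b s' => ∃ a ∈ D.support, g a = b ∧ R a s' := by
  obtain ⟨μ, rfl, h2, h3⟩ := h
  refine ⟨μ.map fun o => (g o.1, o.2), ?_, fun o ho => ?_, fun k q t ht => ?_⟩
  · simp only [PMF.map_comp]; rfl
  · rw [PMF.support_map] at ho
    obtain ⟨o, ho, rfl⟩ := ho
    exact ⟨⟨o.1, by rw [PMF.support_map]; exact ⟨o, ho, rfl⟩, rfl, (h2 o ho).1⟩, (h2 o ho).2⟩
  · rw [h3 k q t ht, PMF.bind_map]; rfl

/-- Two values that are determined by the same random variable are interchangeable. -/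
theorem Spec.reindex (h : Spec O K s T m D R) (g : α → γ) {E : PMF β} {e : β → γ}
    (he : e.Injective) (hE : D.map g = E.map e) :
    Spec O K s T m E fun b s' => ∃ a, g a = e b ∧ R a s' := by
  have : Nonempty β := ⟨E.support_nonempty.some⟩
  have hD : D.map (Function.invFun e ∘ g) = E := by
    rw [← PMF.map_comp, hE, PMF.map_comp, Function.invFun_comp he, PMF.map_id]
  have h' := h.map (Function.invFun e ∘ g)
  rw [hD] at h'
  refine h'.mono le_rfl le_rfl ?_
  rintro b - s' ⟨a, ha, rfl, hR⟩
  refine ⟨a, ?_, hR⟩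
  have : g a ∈ (E.map e).support := by rw [← hE, PMF.support_map]; exact ⟨a, ha, rfl⟩
  rw [PMF.support_map] at this
  obtain ⟨b, -, hb⟩ := this
  exact (Function.invFun_eq ⟨b, hb⟩).symm

/-- Sequential composition: `Spec` allows any continuation and any later time, so the second run can
be inserted after the first. Actual step counts may be random; only their bounds are added. -/
theorem Spec.append {K' : List Cmd} {T' m' : ℕ} {E : α → PMF β} {R' : β → Store → Prop}
    (h : Spec O K s T m D R)
    (h' : ∀ a ∈ D.support, ∀ s', R a s' → Spec O K' s' T' m' (E a) R') :
    Spec O (K ++ K') s (T + T') (m + m') (D.bind E) R' := by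
  classical
  obtain ⟨μ, rfl, h2, h3⟩ := h
  have key : ∀ o : α × Store × ℕ × ℕ, o ∈ μ.support → Spec O K' o.2.1 T' m' (E o.1) R' :=
    fun o ho => h' _ (by rw [PMF.support_map]; exact ⟨o, ho, rfl⟩) _ (h2 o ho).1
  have : Nonempty (PMF (β × Store × ℕ × ℕ)) :=
    ⟨(key _ μ.support_nonempty.some_mem).choose⟩
  choose! ν n1 n2 n3 using key
  refine ⟨μ.bind fun o => (ν o).map fun o' => (o'.1, o'.2.1, o.2.2.1 + o'.2.2.1,
    o.2.2.2 + o'.2.2.2), ?_, fun o ho => ?_, fun k q t ht => ?_⟩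
  · rw [PMF.map_bind, PMF.bind_map]
    refine bind_congr_support _ fun o ho => ?_
    rw [PMF.map_comp]
    exact n1 o ho
  · simp only [PMF.mem_support_bind_iff, PMF.support_map, Set.mem_image] at ho
    obtain ⟨a, ha, o', ho', rfl⟩ := ho
    have := n2 a ha o' ho'
    have := h2 a ha
    exact ⟨by tauto, by dsimp only; omega, by dsimp only; omega⟩
  · rw [List.append_assoc, h3 _ _ _ (by omega), PMF.bind_bind]
    refine bind_congr_support _ fun o ho => ?_
    have := h2 o ho
    rw [n3 o ho _ _ _ (by omega), PMF.bind_map]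
    congr 1
    funext o'
    simp only [Function.comp, Nat.sub_sub, Nat.add_assoc]

/-- The common source of the rules for single commands: a command that replaces itself by `L b` and
makes `d` queries, for a random `b` with distribution `ν`. -/
theorem Spec.step {c : Cmd} {ν : PMF β} {L : β → List Cmd} {s' : β → Store} {d : ℕ}
    {E : β → PMF α}
    (h : ∀ k q, InaccessibleEntropy.step O ⟨c :: k, s, q⟩ =
      ν.map fun b => ⟨L b ++ k, s' b, q + d⟩)
    (h' : ∀ b ∈ ν.support, Spec O (L b ++ K) (s' b) T m (E b) R) :
    Spec O (c :: K) s (T + 1) (d + m) (ν.bind E) R := by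
  have : Nonempty (PMF (α × Store × ℕ × ℕ)) :=
    ⟨(h' _ ν.support_nonempty.some_mem).choose⟩
  choose! μ n1 n2 n3 using h'
  refine ⟨ν.bind fun b => (μ b).map fun o => (o.1, o.2.1, o.2.2.1 + 1, d + o.2.2.2), ?_,
    fun o ho => ?_, fun k q t ht => ?_⟩
  · rw [PMF.map_bind]
    refine bind_congr_support _ fun o ho => ?_
    rw [PMF.map_comp, ← n1 o ho]; rfl
  · simp only [PMF.mem_support_bind_iff, PMF.support_map, Set.mem_image] at ho
    obtain ⟨b, hb, o', ho', rfl⟩ := ho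
    have := n2 b hb o' ho'
    exact ⟨by tauto, by dsimp only; omega, by dsimp only; omega⟩
  · obtain ⟨t, rfl⟩ : ∃ t', t = t' + 1 := ⟨t - 1, by omega⟩
    rw [List.cons_append, run, h, PMF.bind_map, PMF.bind_bind]
    refine bind_congr_support _ fun b hb => ?_
    simp only [Function.comp_apply]
    rw [← List.append_assoc, n3 b hb _ _ _ (by omega), PMF.bind_map]
    congr 1
    funext o'
    simp only [Function.comp, Nat.add_sub_add_right, Nat.add_assoc]

theorem Spec.det {c : Cmd} {L : List Cmd} {s' : Store}
    (h : ∀ k q, InaccessibleEntropy.step O ⟨c :: k, s, q⟩ = PMF.pure ⟨L ++ k, s', q⟩)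
    (h' : Spec O (L ++ K) s' T m D R) : Spec O (c :: K) s (T + 1) m D R := by
  have := Spec.step (c := c) (K := K) (ν := PMF.pure ()) (L := fun _ => L) (s' := fun _ => s')
    (d := 0) (E := fun _ => D) (s := s) (fun k q => by simp [h, PMF.pure_map]) (fun _ _ => h')
  simpa using this

theorem Spec.skip (h : Spec O K s T m D R) : Spec O (.skip :: K) s (T + 1) m D R :=
  Spec.det (L := []) (fun _ _ => rfl) h

theorem Spec.clear {r : ℕ} (h : Spec O K (Function.update s r []) T m D R) :
    Spec O (.clear r :: K) s (T + 1) m D R :=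
  Spec.det (L := []) (fun _ _ => rfl) h

theorem Spec.copy {r r' : ℕ} (h : Spec O K (Function.update s r (s r')) T m D R) :
    Spec O (.copy r r' :: K) s (T + 1) m D R :=
  Spec.det (L := []) (fun _ _ => rfl) h

theorem Spec.push {r : ℕ} {b : Bool} (h : Spec O K (Function.update s r (b :: s r)) T m D R) :
    Spec O (.push r b :: K) s (T + 1) m D R :=
  Spec.det (L := []) (fun _ _ => rfl) h

theorem Spec.pop {r : ℕ} (h : Spec O K (Function.update s r (s r).tail) T m D R) :
    Spec O (.pop r :: K) s (T + 1) m D R :=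
  Spec.det (L := []) (fun _ _ => rfl) h

theorem Spec.flip {r : ℕ} {E : Bool → PMF α}
    (h : ∀ b, Spec O K (Function.update s r (b :: s r)) T m (E b) R) :
    Spec O (.flip r :: K) s (T + 1) m ((PMF.uniformOfFintype Bool).bind E) R := by
  have := Spec.step (c := .flip r) (L := fun _ => []) (d := 0) (fun _ _ => rfl) fun b _ => h b
  simpa using this

theorem Spec.query {r r' : ℕ} {E : Word × Word → PMF α}
    (h : ∀ a ∈ (O (s r, s r')).support,
      Spec O K (Function.update (Function.update s r a.1) r' a.2) T m (E a) R) :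
    Spec O (.query r r' :: K) s (T + 1) (1 + m) ((O (s r, s r')).bind E) R :=
  Spec.step (c := .query r r') (L := fun _ => []) (d := 1) (fun _ _ => rfl) h

theorem Spec.seq {c d : Cmd} (h : Spec O (c :: d :: K) s T m D R) :
    Spec O (.seq c d :: K) s (T + 1) m D R :=
  Spec.det (L := [c, d]) (fun _ _ => rfl) h

theorem Spec.cases_nil {r : ℕ} {e c d : Cmd} (hr : s r = []) (h : Spec O (e :: K) s T m D R) :
    Spec O (.cases r e c d :: K) s (T + 1) m D R :=
  Spec.det (L := [e]) (fun _ _ => by simp [InaccessibleEntropy.step, hr]) h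

theorem Spec.cases_false {r : ℕ} {e c d : Cmd} {w : Word} (hr : s r = false :: w)
    (h : Spec O (c :: K) s T m D R) : Spec O (.cases r e c d :: K) s (T + 1) m D R :=
  Spec.det (L := [c]) (fun _ _ => by simp [InaccessibleEntropy.step, hr]) h

theorem Spec.cases_true {r : ℕ} {e c d : Cmd} {w : Word} (hr : s r = true :: w)
    (h : Spec O (d :: K) s T m D R) : Spec O (.cases r e c d :: K) s (T + 1) m D R :=
  Spec.det (L := [d]) (fun _ _ => by simp [InaccessibleEntropy.step, hr]) h

theorem Spec.loop_nil {r : ℕ} {c : Cmd} (hr : s r = []) (h : Spec O K s T m D R) :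
    Spec O (.loop r c :: K) s (T + 1) m D R :=
  Spec.det (L := []) (fun _ _ => by simp [InaccessibleEntropy.step, hr]) h

theorem Spec.loop_cons {r : ℕ} {c : Cmd} {b : Bool} {w : Word} (hr : s r = b :: w)
    (h : Spec O (c :: .loop r c :: K) s T m D R) :
    Spec O (.loop r c :: K) s (T + 1) m D R :=
  Spec.det (L := [c, .loop r c]) (fun _ _ => by simp [InaccessibleEntropy.step, hr]) h

/-- Run `K` for its effect on the store only. -/
theorem Spec.andThen {K' : List Cmd} {T' m' : ℕ} {E : PMF β} {R' : β → Store → Prop} {a : α}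
    (h : Spec O K s T m (PMF.pure a) R)
    (h' : ∀ s', R a s' → Spec O K' s' T' m' E R') :
    Spec O (K ++ K') s (T + T') (m + m') E R' := by
  have := h.append (E := fun _ => E) (R' := R') (K' := K') (T' := T') (m' := m')
    (fun b hb s' hs => by
      rw [PMF.mem_support_pure_iff] at hb
      subst hb
      exact h' s' hs)
  simpa using this

/-! ### From specifications to halting, query count and output -/

section Top

variable {c : Cmd} {w : Word × Word} {t : ℕ}

theorem Spec.run_eq (h : Spec O [c] (start c w).store T m D R) (ht : T ≤ t) :
    ∃ μ : PMF (α × Store × ℕ), μ.map Prod.fst = D ∧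
      (∀ o ∈ μ.support, R o.1 o.2.1 ∧ o.2.2 ≤ m) ∧
      run O t (start c w) = μ.map fun o => ⟨[], o.2.1, o.2.2⟩ := by
  obtain ⟨μ, h1, h2, h3⟩ := h
  refine ⟨μ.map fun o => (o.1, o.2.1, o.2.2.2), ?_, fun o ho => ?_, ?_⟩
  · rw [PMF.map_comp, ← h1]; rfl
  · rw [PMF.support_map] at ho
    obtain ⟨o, ho, rfl⟩ := ho
    exact ⟨(h2 o ho).1, (h2 o ho).2.2⟩
  · have := h3 [] 0 t ht
    simp only [run_halted, Nat.zero_add] at this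
    rw [PMF.map_comp]
    exact this

theorem Spec.haltsIn (h : Spec O [c] (start c w).store T m D R) (ht : T ≤ t) :
    HaltsIn O c w t := by
  obtain ⟨μ, -, -, h3⟩ := h.run_eq ht
  intro σ hσ
  rw [h3, PMF.support_map] at hσ
  obtain ⟨o, -, rfl⟩ := hσ
  rfl

theorem Spec.queriesAtMost (h : Spec O [c] (start c w).store T m D R) (ht : T ≤ t) :
    QueriesAtMost O c w t m := by
  obtain ⟨μ, -, h2, h3⟩ := h.run_eq ht
  intro σ hσ
  rw [h3, PMF.support_map] at hσ
  obtain ⟨o, ho, rfl⟩ := hσ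
  exact (h2 o ho).2

theorem Spec.output_map_fst {g : α → Word} (h : Spec O [c] (start c w).store T m D R)
    (ht : T ≤ t) (hg : ∀ a s', R a s' → s' 0 = g a) :
    (output O c w t).map Prod.fst = D.map g := by
  obtain ⟨μ, h1, h2, h3⟩ := h.run_eq ht
  rw [output, h3, PMF.map_comp, PMF.map_comp, ← h1, PMF.map_comp, ← PMF.bind_pure_comp,
    ← PMF.bind_pure_comp]
  refine bind_congr_support _ fun o ho => ?_
  simp [hg _ _ (h2 o ho).1]

end Top

/-! ### Running a program on shifted registers -/

/-- The program with all registers shifted by `N`. -/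
def Cmd.shift (N : ℕ) : Cmd → Cmd
  | .skip => .skip
  | .clear r => .clear (N + r)
  | .copy r t => .copy (N + r) (N + t)
  | .push r b => .push (N + r) b
  | .pop r => .pop (N + r)
  | .flip r => .flip (N + r)
  | .query r t => .query (N + r) (N + t)
  | .seq c d => .seq (c.shift N) (d.shift N)
  | .cases r e c d => .cases (N + r) (e.shift N) (c.shift N) (d.shift N)
  | .loop r c => .loop (N + r) (c.shift N)

/-- A strict upper bound on the registers that a program mentions. -/
def Cmd.bound : Cmd → ℕ
  | .skip => 0
  | .clear r => r + 1
  | .copy r t => max (r + 1) (t + 1)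
  | .push r _ => r + 1
  | .pop r => r + 1
  | .flip r => r + 1
  | .query r t => max (r + 1) (t + 1)
  | .seq c d => max c.bound d.bound
  | .cases r e c d => max (r + 1) (max e.bound (max c.bound d.bound))
  | .loop r c => max (r + 1) c.bound

theorem Cmd.OracleFree.shift {c : Cmd} (N : ℕ) (h : c.OracleFree) : (c.shift N).OracleFree := by
  induction c <;> simp_all [Cmd.OracleFree, Cmd.shift]

/-- The registers `N, …, N + B - 1` of `s'` hold the words that the registers `0, …, B - 1` of `u`
hold, and the other registers are as in `s`. -/
def Window (N B : ℕ) (s u s' : Store) : Prop :=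
  (∀ r < B, s' (N + r) = u r) ∧ ∀ r, r < N ∨ N + B ≤ r → s' r = s r

theorem Window.update {N B r : ℕ} {s u s' : Store} (h : Window N B s u s') (hr : r < B)
    (w : Word) : Window N B s (Function.update u r w) (Function.update s' (N + r) w) := by
  refine ⟨fun i hi => ?_, fun i hi => ?_⟩
  · by_cases hir : i = r
    · subst hir; simp
    · rw [Function.update_of_ne (by omega), Function.update_of_ne hir, h.1 i hi]
  · rw [Function.update_of_ne (by omega), h.2 i hi]

/-- The shifted program simulates the original step by step, with the same coins and the same
branches, because `Window` keeps the two register blocks equal. Induction is on the number of steps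
of the original, as loops rule out an induction on programs. Being oracle-free, the program behaves
in the same way under any `O`. -/
theorem spec_shift {N B : ℕ} {s₀ : Store} (O : Oracle) (T : ℕ) :
    ∀ (K : List Cmd) (u s : Store) (q : ℕ), (∀ c ∈ K, c.OracleFree ∧ c.bound ≤ B) →
      Window N B s₀ u s → (∀ σ ∈ (run noOracle T ⟨K, u, q⟩).support, σ.cont = []) →
      Spec O (K.map (Cmd.shift N)) s T 0 ((run noOracle T ⟨K, u, q⟩).map Config.store)
        (Window N B s₀) := by
  have hnil : ∀ (T : ℕ) (u s : Store) (q : ℕ), Window N B s₀ u s →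
      Spec O (([] : List Cmd).map (Cmd.shift N)) s T 0
        ((run noOracle T ⟨[], u, q⟩).map Config.store) (Window N B s₀) := by
    intro T u s q hW
    rw [run_halted, PMF.pure_map]
    exact (Spec.nil hW).mono (Nat.zero_le _) le_rfl fun _ _ _ h => h
  induction T with
  | zero =>
    intro K u s q hK hW hH
    -- Halting within zero steps means that no command is left.
    obtain rfl : K = [] := hH ⟨K, u, q⟩ (by simp [run])
    exact hnil _ _ _ _ hW
  | succ T ih =>
    intro K u s q hK hW hH
    rcases K with _ | ⟨c, K⟩
    · exact hnil _ _ _ _ hW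
    have hK' : ∀ c ∈ K, c.OracleFree ∧ c.bound ≤ B := fun d hd => hK d (by simp [hd])
    obtain ⟨hO, hB⟩ := hK c (by simp)
    rw [run] at hH ⊢
    rw [List.map_cons]
    rcases c with _ | r | ⟨r, t⟩ | ⟨r, b⟩ | r | r | ⟨r, t⟩ | ⟨c, d⟩ | ⟨r, e, c, d⟩ | ⟨r, c⟩ <;>
      simp only [step, PMF.pure_bind, Cmd.shift, Cmd.bound, max_le_iff, Nat.succ_le_iff,
        Cmd.OracleFree] at *
    · exact (ih K u s q hK' hW hH).skip
    · exact (ih K _ _ q hK' (hW.update hB _) hH).clear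
    · rw [← hW.1 t hB.2] at hH ⊢
      exact (ih K _ _ q hK' (hW.update hB.1 _) hH).copy
    · rw [← hW.1 r hB] at hH ⊢
      exact (ih K _ _ q hK' (hW.update hB _) hH).push
    · rw [← hW.1 r hB] at hH ⊢
      exact (ih K _ _ q hK' (hW.update hB _) hH).pop
    · rw [PMF.bind_map, PMF.map_bind]
      refine Spec.flip fun b => ?_
      rw [Function.comp_apply, ← hW.1 r hB]
      refine ih K _ _ q hK' (hW.update hB _) fun σ hσ => hH σ ?_
      rw [PMF.bind_map, PMF.mem_support_bind_iff]
      refine ⟨b, by simp, ?_⟩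
      rw [Function.comp_apply, ← hW.1 r hB]
      exact hσ
    · exact (ih (c :: d :: K) u s q (by simp; tauto) hW hH).seq
    · have := hW.1 r hB.1
      rcases hu : u r with _ | ⟨_ | _, w⟩ <;> rw [hu] at this <;> simp only [hu] at hH ⊢
      · exact Spec.cases_nil this (ih (e :: K) u s q (by simp; tauto) hW hH)
      · exact Spec.cases_false this (ih (c :: K) u s q (by simp; tauto) hW hH)
      · exact Spec.cases_true this (ih (d :: K) u s q (by simp; tauto) hW hH)
    · have := hW.1 r hB.1
      rcases hu : u r with _ | ⟨b, w⟩ <;> rw [hu] at this <;> simp only [hu] at hH ⊢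
      · exact Spec.loop_nil this (ih K u s q hK' hW hH)
      · refine Spec.loop_cons this (ih (c :: .loop r c :: K) u s q ?_ hW hH)
        simp [Cmd.OracleFree, Cmd.bound]; tauto

/-- Clear the registers `N, …, N + B - 1`. -/
def clearWindow (N : ℕ) : ℕ → Cmd
  | 0 => .skip
  | B + 1 => .seq (.clear (N + B)) (clearWindow N B)

theorem clearWindow_oracleFree (N B : ℕ) : (clearWindow N B).OracleFree := by
  induction B <;> simp_all [clearWindow, Cmd.OracleFree]

theorem spec_clearWindow (O : Oracle) (N B : ℕ) (s : Store) :
    Spec O [clearWindow N B] s (2 * B + 1) 0 (PMF.pure ()) fun _ => Window N B s fun _ => [] := by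
  induction B generalizing s with
  | zero => exact Spec.skip (Spec.nil ⟨by simp, fun _ _ => rfl⟩)
  | succ B ih =>
    refine Spec.seq (Spec.clear ((ih (Function.update s (N + B) [])).mono le_rfl le_rfl ?_))
    rintro - - s' ⟨h1, h2⟩
    refine ⟨fun r hr => ?_, fun r hr => ?_⟩
    · rcases (Nat.lt_succ_iff_lt_or_eq.1 hr) with h | rfl
      · exact h1 r h
      · rw [h2 _ (by omega)]; simp
    · rw [h2 _ (by omega), Function.update_of_ne (by omega)]

/-- Run `c` as a subroutine on the registers `N, …, N + B - 1`, with the contents of the registers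
`a` and `b` as input. -/
def call (N B : ℕ) (c : Cmd) (a b : ℕ) : Cmd :=
  .seq (clearWindow N B) (.seq (.copy N a) (.seq (.copy (N + 1) b) (c.shift N)))

theorem call_oracleFree {N B a b : ℕ} {c : Cmd} (h : c.OracleFree) :
    (call N B c a b).OracleFree := by
  simp [call, Cmd.OracleFree, clearWindow_oracleFree, h.shift N]

/-- The window is cleared first, so that a subroutine called repeatedly always sees the initial
store it expects. The condition `2 ≤ B` keeps both input registers inside the window, even if `c`
does not mention them. -/
theorem spec_call {N B a b : ℕ} {c : Cmd} {w : Word × Word} (O : Oracle) (hc : c.OracleFree)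
    (hB : c.bound ≤ B) (hB2 : 2 ≤ B) (ha : a < N) (hb : b < N) (h : HaltsIn noOracle c w T)
    (s : Store) (hwa : s a = w.1) (hwb : s b = w.2) :
    Spec O [call N B c a b] s (T + 2 * B + 7) 0
      ((run noOracle T (start c w)).map Config.store) (Window N B s) := by
  refine Spec.mono (T := 2 * B + 1 + (T + 1 + 1 + 1 + 1) + 1) (m := 0 + 0) (Spec.seq ?_)
    (by omega) le_rfl fun _ _ _ h => h
  refine (spec_clearWindow O N B s).andThen (K := [_]) fun s₁ h₁ => ?_
  have e : ∀ r < N, s₁ r = s r := fun r hr => h₁.2 r (Or.inl hr)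
  refine Spec.seq (Spec.copy (Spec.seq (Spec.copy ?_)))
  refine spec_shift (s₀ := s) O T [c] _ _ 0 (by simp [hc, hB]) ⟨fun r hr => ?_, fun r hr => ?_⟩ h
  · have h3 := h₁.1 r hr
    rcases r with _ | _ | r
    · simp [e a ha, hwa]
    · rw [Function.update_self, Function.update_of_ne (by omega), e b hb, hwb]; simp
    · rw [Function.update_of_ne (by omega), Function.update_of_ne (by omega), h3]
      simp
  · rw [Function.update_of_ne (by omega), Function.update_of_ne (by omega), h₁.2 r hr]

end ProgramLogic

/-! ### The inverter as a program -/

section Inverter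

variable {O : Oracle} {s : Store} {n : ℕ}

/-! ### Common prefixes -/

/-- The length of the longest common prefix of two words. -/
def commonPrefix : Word → Word → ℕ
  | a :: v, b :: w => if a = b then commonPrefix v w + 1 else 0
  | _, _ => 0

theorem commonPrefix_lt : ∀ {v w : Word}, v.length = w.length → v ≠ w →
    commonPrefix v w < v.length
  | [], [], _, h => absurd rfl h
  | a :: v, b :: w, hl, h => by
    rw [commonPrefix]
    split_ifs with hab
    · simpa using commonPrefix_lt (by simpa using hl) (by rintro rfl; exact h (by rw [hab]))
    · simp

theorem getElem?_eq_of_lt_commonPrefix : ∀ {v w : Word} {i : ℕ}, i < commonPrefix v w →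
    v[i]? = w[i]?
  | [], _, _, h => by simp [commonPrefix] at h
  | _ :: _, [], _, h => by simp [commonPrefix] at h
  | a :: v, b :: w, i, h => by
    rw [commonPrefix] at h
    split_ifs at h with hab
    · rcases i with _ | i
      · simp [hab]
      · simpa using getElem?_eq_of_lt_commonPrefix (by simpa using h)
    · simp at h

theorem getElem?_commonPrefix_ne : ∀ {v w : Word}, v.length = w.length → v ≠ w →
    v[commonPrefix v w]? ≠ w[commonPrefix v w]?
  | [], [], _, h => absurd rfl h
  | a :: v, b :: w, hl, h => by
    rw [commonPrefix]
    split_ifs with hab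
    · simpa using getElem?_commonPrefix_ne (by simpa using hl)
        (by rintro rfl; exact h (by rw [hab]))
    · simpa using hab

/-- Compare the words in registers `4` and `5`, prepending their common prefix (in unary) to
register `6` and, if they differ, `true` to register `7`. -/
def compareCmd : Cmd :=
  let agree : Cmd := .seq (.pop 4) (.seq (.pop 5) (.push 6 true))
  let differ : Cmd := .seq (.clear 4) (.push 7 true)
  .loop 4 (.cases 5 .skip (.cases 4 .skip agree differ) (.cases 4 .skip differ agree))

/-- Eight steps per letter: the loop test, two case distinctions and the five steps of `agree`. At
the first disagreement register `4` is cleared, which ends the loop. -/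
theorem spec_compareCmd (O : Oracle) : ∀ (v w : Word) (s : Store), v.length = w.length →
    s 4 = v → s 5 = w →
    Spec O [compareCmd] s (8 * v.length + 1) 0 (PMF.pure ()) fun _ s' =>
      s' 6 = List.replicate (commonPrefix v w) true ++ s 6 ∧
      s' 7 = (if v = w then s 7 else true :: s 7) ∧ s' 0 = s 0 ∧ s' 1 = s 1 ∧ s' 3 = s 3
  | [], [], s, _, h4, _ =>
    (Spec.loop_nil h4 (Spec.nil (R := fun _ s' => s' = s) rfl)).mono (by simp) le_rfl
      (by rintro - - _ rfl; simp [commonPrefix])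
  | a :: v, b :: w, s, hl, h4, h5 => by
    have hl' : v.length = w.length := by simpa using hl
    have agree : a = b → Spec O [.seq (.pop 4) (.seq (.pop 5) (.push 6 true)), compareCmd] s
        (8 * v.length + 6) 0 (PMF.pure ()) fun _ s' =>
          s' 6 = List.replicate (commonPrefix (a :: v) (b :: w)) true ++ s 6 ∧
          s' 7 = (if a :: v = b :: w then s 7 else true :: s 7) ∧
          s' 0 = s 0 ∧ s' 1 = s 1 ∧ s' 3 = s 3 := by
      rintro rfl
      refine Spec.seq (Spec.pop (Spec.seq (Spec.pop (Spec.push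
        ((spec_compareCmd O v w _ hl' ?_ ?_).mono le_rfl le_rfl ?_)))))
      · simp [h4]
      · simp [h5]
      · rintro - - s' ⟨h6, h7, h0, h1, h3⟩
        refine ⟨?_, ?_, by simpa using h0, by simpa using h1, by simpa using h3⟩
        · rw [h6, commonPrefix, if_pos rfl, List.replicate_succ']; simp
        · rw [h7]; simp
    have differ : a ≠ b → Spec O [.seq (.clear 4) (.push 7 true), compareCmd] s
        (8 * v.length + 6) 0 (PMF.pure ()) fun _ s' =>
          s' 6 = List.replicate (commonPrefix (a :: v) (b :: w)) true ++ s 6 ∧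
          s' 7 = (if a :: v = b :: w then s 7 else true :: s 7) ∧
          s' 0 = s 0 ∧ s' 1 = s 1 ∧ s' 3 = s 3 := by
      intro hab
      refine Spec.mono (T := 4) (Spec.seq (Spec.clear (Spec.push (Spec.loop_nil (by simp)
        (Spec.nil (R := fun _ s' => s' = _) rfl))))) (by omega) le_rfl ?_
      rintro - - _ rfl
      simp [commonPrefix, hab]
    refine Spec.mono (T := 8 * v.length + 6 + 1 + 1 + 1)
      (R := fun _ s' => s' 6 = List.replicate (commonPrefix (a :: v) (b :: w)) true ++ s 6 ∧
          s' 7 = (if a :: v = b :: w then s 7 else true :: s 7) ∧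
          s' 0 = s 0 ∧ s' 1 = s 1 ∧ s' 3 = s 3)
      (Spec.loop_cons h4 ?_) (by simp; omega) le_rfl fun _ _ _ h => h
    rcases b
    · refine Spec.cases_false h5 ?_
      rcases a
      · exact Spec.cases_false h4 (agree rfl)
      · exact Spec.cases_true h4 (differ (by simp))
    · refine Spec.cases_true h5 ?_
      rcases a
      · exact Spec.cases_false h4 (differ (by simp))
      · exact Spec.cases_true h4 (agree rfl)

/-! ### The inverter -/

/-- The length of the common prefix of two different strings. -/
def prefixIndex {y y' : Bits n} (h : y ≠ y') : Fin n :=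
  ⟨commonPrefix (List.ofFn y) (List.ofFn y'), by
    simpa using commonPrefix_lt (by simp) fun e => h (List.ofFn_injective e)⟩

theorem eq_of_lt_prefixIndex {y y' : Bits n} (h : y ≠ y') {i : Fin n}
    (hi : i < prefixIndex h) : y i = y' i := by
  simpa using getElem?_eq_of_lt_commonPrefix hi

theorem ne_prefixIndex {y y' : Bits n} (h : y ≠ y') :
    y (prefixIndex h) ≠ y' (prefixIndex h) := by
  have h1 := getElem?_commonPrefix_ne (v := List.ofFn y) (w := List.ofFn y') (by simp)
    fun e => h (List.ofFn_injective e)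
  have h2 := (prefixIndex h).2
  simp only [prefixIndex] at h2 ⊢
  simpa [h2] using h1

open Classical in
/-- One step of the inverter: if `x` is not yet a preimage of `y`, ask the collision finder for a
string whose image agrees with that of `x` as far as the latter agrees with `y`. -/
def move (f : Bits n → Bits n) (A : Dom n → PMF (Dom n)) (y x : Bits n) : PMF (Bits n) :=
  if h : f x = y then PMF.pure x else (A (x, prefixIndex h)).map Prod.fst

/-- `t` steps of the inverter. -/
def walk (f : Bits n → Bits n) (A : Dom n → PMF (Dom n)) (y : Bits n) : ℕ → Bits n → PMF (Bits n)
  | 0, x => PMF.pure x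
  | t + 1, x => (move f A y x).bind (walk f A y t)

/-- The program `ask` applies `A` to the pair in registers `1` and `6`. -/
def Asks (O : Oracle) (ask : Cmd) (A : Dom n → PMF (Dom n)) (T m : ℕ) : Prop :=
  ∀ (s : Store) (z : Dom n), s 1 = (encode z).1 → s 6 = (encode z).2 →
    Spec O [ask] s T m (A z) fun z' s' => s' 1 = List.ofFn z'.1 ∧ s' 0 = s 0 ∧ s' 3 = s 3

/-- The program for `move`, where `c` computes `f`; register `0` holds `y`
and register `1` holds `x`. -/
def moveCmd (c ask : Cmd) : Cmd :=
  .seq (.clear 2) (.seq (call 9 (max c.bound 2) c 1 2) (.seq (.copy 4 9) (.seq (.copy 5 0)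
    (.seq (.clear 6) (.seq (.push 6 true) (.seq (.clear 7) (.seq compareCmd
      (.cases 7 .skip .skip ask))))))))

/-- Register `0` holds the target, `1` the current point, `2` the empty second input of `c`, `3` the
remaining step count, `4` to `7` serve the comparison, and the window of `c` starts at `9`. -/
theorem spec_moveCmd {f : Bits n → Bits n} {A : Dom n → PMF (Dom n)} {c ask : Cmd}
    {Tf Ta m : ℕ} (hc : c.OracleFree) (hask : Asks O ask A Ta m) (x y : Bits n)
    (hf : HaltsIn noOracle c (encodeBits x) Tf)
    (hfx : (output noOracle c (encodeBits x) Tf).map Prod.fst = PMF.pure (List.ofFn (f x)))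
    (h0 : s 0 = List.ofFn y) (h1 : s 1 = List.ofFn x) :
    Spec O [moveCmd c ask] s (Tf + 2 * max c.bound 2 + Ta + 8 * n + 30) m (move f A y x)
      fun x' s' => s' 1 = List.ofFn x' ∧ s' 0 = List.ofFn y ∧ s' 3 = s 3 := by
  -- Of the final store of `c` only register `0` matters, and it is deterministic; reindexing by the
  -- one-point type forgets the distribution of everything else.
  have hcall := (spec_call (N := 9) (a := 1) (b := 2) O hc (le_max_left _ 2) (le_max_right _ _)
    (by norm_num) (by norm_num) hf (Function.update s 2 []) (by simp [h1, encodeBits])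
    (by simp [encodeBits])).reindex (fun u => u 0) (E := PMF.pure ())
    (e := fun _ => List.ofFn (f x)) (fun _ _ _ => rfl) (by
      rw [PMF.pure_map, ← hfx, output, PMF.map_comp, PMF.map_comp]; rfl)
  refine Spec.mono (R := fun x' s' => s' 1 = List.ofFn x' ∧ s' 0 = List.ofFn y ∧ s' 3 = s 3)
    (Spec.seq (Spec.clear (Spec.seq (hcall.andThen
    (K' := [_]) (m' := m) (T' := 8 * n + Ta + 15) fun s₁ ⟨u, hu, hw1, hw2⟩ => ?_))))
    (by omega) (by omega) fun _ _ _ h => h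
  have e0 : s₁ 0 = List.ofFn y := by rw [hw2 0 (by simp)]; simpa using h0
  have e1 : s₁ 1 = List.ofFn x := by rw [hw2 1 (by simp)]; simpa using h1
  have e3 : s₁ 3 = s 3 := by rw [hw2 3 (by simp)]; simp
  have e9 : s₁ 9 = List.ofFn (f x) := by rw [← hu]; simpa using hw1 0 (by simp)
  refine Spec.mono (R := fun x' s' => s' 1 = List.ofFn x' ∧ s' 0 = List.ofFn y ∧ s' 3 = s 3)
    (Spec.seq (Spec.copy (Spec.seq (Spec.copy (Spec.seq (Spec.clear (Spec.seq
    (Spec.push (Spec.seq (Spec.clear (Spec.seq ((spec_compareCmd O (List.ofFn (f x)) (List.ofFn y) _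
      (by simp) ?_ ?_).andThen (K' := [_]) (m' := m) (T' := Ta + 2) ?_))))))))))))
    (by simp; omega) (by omega) fun _ _ _ h => h
  · simp [e9]
  · simp [e0]
  rintro s₂ ⟨g6, g7, g0, g1, g3⟩
  simp [e0, e1, e3, List.ofFn_injective.eq_iff] at g6 g7 g0 g1 g3
  rw [move]
  split_ifs at g7 ⊢ with h
  · exact (Spec.cases_nil g7 (Spec.skip (Spec.nil
      (R := fun x' s' => s' 1 = List.ofFn x' ∧ s' 0 = List.ofFn y ∧ s' 3 = s 3)
      ⟨g1, g0, g3⟩))).mono (by omega) (by omega) fun _ _ _ h => h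
  · refine Spec.mono (Spec.cases_true g7 ((hask s₂ (x, prefixIndex h) g1 ?_).map Prod.fst))
      (by omega) le_rfl ?_
    -- The letter pushed to register `6` before the comparison turns the prefix length `j` into the
    -- unary code of the index `j + 1`.
    · rw [g6, encode, prefixIndex, List.replicate_succ']
    · rintro _ - s' ⟨z, -, rfl, k1, k0, k3⟩
      exact ⟨k1, k0.trans g0, k3.trans g3⟩

/-- The program for `walk`; the number of steps is the length of register `3`. -/
def walkCmd (c ask : Cmd) : Cmd := .loop 3 (.seq (.pop 3) (moveCmd c ask))

theorem spec_walkCmd {f : Bits n → Bits n} {A : Dom n → PMF (Dom n)} {c ask : Cmd} {Tf Ta m : ℕ}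
    (hc : c.OracleFree) (hask : Asks O ask A Ta m)
    (hf : ∀ x : Bits n, HaltsIn noOracle c (encodeBits x) Tf ∧
      (output noOracle c (encodeBits x) Tf).map Prod.fst = PMF.pure (List.ofFn (f x)))
    (y : Bits n) : ∀ (w : Word) (s : Store) (x : Bits n), s 3 = w →
    s 0 = List.ofFn y → s 1 = List.ofFn x →
    Spec O [walkCmd c ask] s (w.length * (Tf + 2 * max c.bound 2 + Ta + 8 * n + 33) + 1)
      (w.length * m) (walk f A y w.length x) fun x' s' => s' 1 = List.ofFn x'
  | [], s, x, h3, h0, h1 => by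
    simp only [List.length_nil, zero_mul, zero_add]
    exact Spec.loop_nil h3 (Spec.nil h1)
  | b :: w, s, x, h3, h0, h1 => by
    refine Spec.mono (R := fun x' s' => s' 1 = List.ofFn x') (Spec.loop_cons h3 (Spec.seq (Spec.pop
      ((spec_moveCmd (f := f) hc hask x y (hf x).1 (hf x).2 ?_ ?_).append (K' := [walkCmd c ask])
        (E := walk f A y w.length) (fun x' hx' s' ⟨k1, k0, k3⟩ =>
          spec_walkCmd hc hask hf y w s' x' ?_ k0 k1)))))
      (by simp only [List.length_cons]; ring_nf; omega)
      (by simp only [List.length_cons]; ring_nf; omega) fun _ _ _ h => h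
    · simpa using h0
    · simpa using h1
    · simpa [h3] using k3

/-- Splits off one coin, to match one iteration of `tossCmd`. -/
theorem uniform_bits_succ (n : ℕ) : PMF.uniformOfFintype (Bits (n + 1)) =
    (PMF.uniformOfFintype Bool).bind fun b =>
      (PMF.uniformOfFintype (Bits n)).map fun z : Bits n => (Fin.cons b z : Bits (n + 1)) := by
  ext x
  rw [PMF.bind_apply, tsum_eq_single (x 0)]
  · rw [PMF.map_apply, tsum_eq_single (Fin.tail x)]
    · simp only [PMF.uniformOfFintype_apply, Fin.cons_self_tail, if_true, Fintype.card_pi,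
        Fintype.card_bool, Finset.prod_const, Finset.card_univ, Fintype.card_fin]
      rw [← ENNReal.mul_inv (by simp) (by simp)]
      push_cast
      rw [pow_succ']
    · intro z hz
      rw [if_neg fun e => hz (by rw [e, Fin.tail_cons])]
  · intro b hb
    rw [PMF.map_apply, ENNReal.tsum_eq_zero.2, mul_zero]
    intro z
    rw [if_neg]
    rintro rfl
    simp at hb

theorem map_uniform_equiv {α : Type} [Fintype α] [Nonempty α] (e : α ≃ α) :
    (PMF.uniformOfFintype α).map e = PMF.uniformOfFintype α := by
  classical
  ext a
  rw [PMF.map_apply, tsum_eq_single (e.symm a)]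
  · simp
  · rintro b hb
    rw [if_neg]
    rintro rfl
    simp at hb

/-- Toss as many coins as register `2` has letters, and put them into register `1`. -/
def tossCmd : Cmd := .loop 2 (.seq (.pop 2) (.flip 1))

theorem spec_tossCmd (O : Oracle) : ∀ (w : Word) (s : Store), s 2 = w →
    Spec O [tossCmd] s (4 * w.length + 1) 0 (PMF.uniformOfFintype (Bits w.length)) fun x s' =>
      s' 1 = (List.ofFn x).reverse ++ s 1 ∧ s' 0 = s 0 ∧ s' 3 = s 3
  | [], s, h => by
    have e : PMF.uniformOfFintype (Bits 0) = PMF.pure (fun i => i.elim0) := by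
      ext x
      simp [PMF.uniformOfFintype_apply, PMF.pure_apply, Subsingleton.elim x (fun i => i.elim0)]
    rw [List.length_nil, e]
    exact Spec.loop_nil h (Spec.nil ⟨by simp, rfl, rfl⟩)
  | b :: w, s, h => by
    have e := uniform_bits_succ w.length
    rw [List.length_cons, e]
    refine Spec.mono (R := fun (x : Bits (w.length + 1)) s' =>
      s' 1 = (List.ofFn x).reverse ++ s 1 ∧ s' 0 = s 0 ∧ s' 3 = s 3) (T := 4 * w.length + 1 + 4)
      (Spec.loop_cons h (Spec.seq (Spec.pop (Spec.flip fun b => Spec.mono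
        ((spec_tossCmd O w _ ?_).map fun z => (Fin.cons b z : Bits (w.length + 1)))
        le_rfl le_rfl ?_)))) (by omega) le_rfl fun _ _ _ h => h
    · simp [h]
    · rintro _ - s' ⟨x, -, rfl, h1, h0, h3⟩
      exact ⟨by simpa [List.ofFn_succ] using h1, by simpa using h0, by simpa using h3⟩

/-- Lengthen register `3` by `k` letters. -/
def lengthenCmd : ℕ → Cmd
  | 0 => .skip
  | k + 1 => .seq (.push 3 true) (lengthenCmd k)

theorem lengthenCmd_oracleFree (k : ℕ) : (lengthenCmd k).OracleFree := by
  induction k <;> simp_all [lengthenCmd, Cmd.OracleFree]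

theorem spec_lengthenCmd (O : Oracle) (k : ℕ) (s : Store) :
    Spec O [lengthenCmd k] s (2 * k + 1) 0 (PMF.pure ()) fun _ s' =>
      (s' 3).length = k + (s 3).length ∧ ∀ r ≠ 3, s' r = s r := by
  induction k generalizing s with
  | zero => exact Spec.skip (Spec.nil (by simp))
  | succ k ih =>
    refine Spec.seq (Spec.push ((ih _).mono le_rfl le_rfl ?_))
    rintro - - s' ⟨h, h'⟩
    refine ⟨by simp at h; omega, fun r hr => ?_⟩
    rw [h' r hr, Function.update_of_ne hr]

/-- Lengthen register `3` by eight times the length of register `2`. -/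
def countCmd : Cmd := .loop 2 (.seq (.pop 2) (lengthenCmd 8))

theorem spec_countCmd (O : Oracle) : ∀ (w : Word) (s : Store), s 2 = w →
    Spec O [countCmd] s (20 * w.length + 1) 0 (PMF.pure ()) fun _ s' =>
      (s' 3).length = 8 * w.length + (s 3).length ∧ s' 0 = s 0 ∧ s' 1 = s 1
  | [], s, h => Spec.loop_nil h (Spec.nil ⟨by simp, rfl, rfl⟩)
  | b :: w, s, h => by
    refine Spec.mono (R := fun _ s' =>
      (s' 3).length = 8 * (w.length + 1) + (s 3).length ∧ s' 0 = s 0 ∧ s' 1 = s 1)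
      (T := 17 + (20 * w.length + 1) + 3) (m := 0 + 0)
      (Spec.loop_cons h (Spec.seq (Spec.pop ((spec_lengthenCmd O 8 _).andThen (K' := [countCmd])
        fun s' ⟨h3, h'⟩ => (spec_countCmd O w s' ?_).mono le_rfl le_rfl ?_))))
      (by simp; omega) le_rfl fun _ _ _ h => h
    · simp [h' 2, h]
    · rintro - - s'' ⟨k3, k0, k1⟩
      exact ⟨by simp at h3; omega, by simp [k0, h' 0], by simp [k1, h' 1]⟩

/-- The inverter: `8 n` steps from a random point. -/
def inverter (c ask : Cmd) : Cmd :=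
  .seq (.copy 2 0) (.seq tossCmd (.seq (.copy 2 0) (.seq countCmd
    (.seq (walkCmd c ask) (.copy 0 1)))))

/-- The distribution of the output of the inverter on input `y`. -/
def inverse (f : Bits n → Bits n) (A : Dom n → PMF (Dom n)) (y : Bits n) : PMF (Bits n) :=
  (PMF.uniformOfFintype (Bits n)).bind (walk f A y (8 * n))

theorem spec_inverter {f : Bits n → Bits n} {A : Dom n → PMF (Dom n)} {c ask : Cmd} {Tf Ta m : ℕ}
    (hc : c.OracleFree) (hask : Asks O ask A Ta m)
    (hf : ∀ x : Bits n, HaltsIn noOracle c (encodeBits x) Tf ∧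
      (output noOracle c (encodeBits x) Tf).map Prod.fst = PMF.pure (List.ofFn (f x)))
    (y : Bits n) :
    Spec O [inverter c ask] (start (inverter c ask) (encodeBits y)).store
      (8 * n * (Tf + 2 * max c.bound 2 + Ta + 8 * n + 33) + 24 * n + 20)
      (8 * n * m) (inverse f A y) fun x' s' => s' 0 = List.ofFn x' := by
  have toss := fun s (h : s 2 = List.ofFn y) => spec_tossCmd O _ s h
  rw [List.length_ofFn] at toss
  refine Spec.mono (R := fun x' s' => s' 0 = List.ofFn x')
    (Spec.seq (Spec.copy (Spec.seq (Spec.append (K := [_]) (K' := [_])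
      (D := PMF.uniformOfFintype (Bits n)) (E := walk f A y (8 * n))
      (R := fun x s' => s' 1 = List.ofFn x ∧ s' 0 = List.ofFn y ∧ s' 3 = [])
      (T := 4 * n + 1) (m := 0) (m' := 8 * n * m)
      (T' := 8 * n * (Tf + 2 * max c.bound 2 + Ta + 8 * n + 33) + 20 * n + 10) ?_ ?_))))
    (by omega) (by omega) fun _ _ _ h => h
  -- The coins are stacked, so the word appears reversed; reversal is a bijection and preserves the
  -- uniform distribution.
  · have := (toss (Function.update (start (inverter c ask) (encodeBits y)).store 2
      ((start (inverter c ask) (encodeBits y)).store 0)) (by simp [start, encodeBits])).map (Equiv.arrowCongr Fin.revPerm (Equiv.refl Bool))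
    rw [map_uniform_equiv] at this
    refine this.mono le_rfl le_rfl ?_
    rintro _ - s' ⟨x, -, rfl, h1, h0, h3⟩
    refine ⟨?_, by simpa [start, encodeBits] using h0, by simpa [start] using h3⟩
    rw [h1]
    simp only [start, encodeBits]
    refine List.ext_getElem (by simp) fun i h h' => ?_
    simp only [List.length_ofFn] at h'
    simp [List.getElem_reverse, Fin.rev, Nat.add_comm, Nat.sub_sub]
  · rintro x - s₁ ⟨h1, h0, h3⟩
    refine Spec.mono (R := fun x' s' => s' 0 = List.ofFn x') (Spec.seq (Spec.copy (Spec.seq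
      ((spec_countCmd O (List.ofFn y) _ ?_).andThen (K' := [_]) (m' := 8 * n * m)
      (T' := 8 * n * (Tf + 2 * max c.bound 2 + Ta + 8 * n + 33) + 3)
      fun s₂ ⟨k3, k0, k1⟩ => ?_))))
      (by simp; omega) (by omega) fun _ _ _ h => h
    · simp [h0]
    have hl : (s₂ 3).length = 8 * n := by simpa [h3] using k3
    have hw := spec_walkCmd (f := f) hc hask hf y (s₂ 3) s₂ x rfl (by simpa [h0] using k0)
      (by simpa [h1] using k1)
    rw [hl] at hw
    refine Spec.seq ?_
    rw [← PMF.bind_pure (walk f A y (8 * n) x)]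
    refine (hw.append (K' := [_]) (T' := 1) (m' := 0) fun x' _ s' h => ?_)
    exact Spec.copy (Spec.nil (by simpa using h))

theorem inverter_oracleFree {c ask : Cmd} (hc : c.OracleFree) (hask : ask.OracleFree) :
    (inverter c ask).OracleFree := by
  simp [inverter, tossCmd, countCmd, lengthenCmd_oracleFree, walkCmd, moveCmd, compareCmd, Cmd.OracleFree,
    call_oracleFree hc, hask]

theorem asks_query (A : Dom n → PMF (Dom n)) :
    Asks (oracleOf A) (.query 1 6) A 1 1 := by
  intro s z h1 h6
  have e : oracleOf A (s 1, s 6) = (A z).map encode := by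
    rw [h1, h6]; exact oracleOf_encode A z
  have := Spec.query (O := oracleOf A) (r := 1) (r' := 6) (s := s) (K := []) (T := 0) (m := 0)
    (E := PMF.pure) (R := fun a s' => s' 1 = a.1 ∧ s' 0 = s 0 ∧ s' 3 = s 3)
    (fun a _ => Spec.nil (by simp))
  rw [PMF.bind_pure, e] at this
  have := this.reindex id (E := A z) (e := encode) (encode_injective n) (by rw [PMF.map_id])
  refine this.mono le_rfl le_rfl ?_
  rintro z' - s' ⟨a, ha, h, h'⟩
  rw [id] at ha
  subst ha
  exact ⟨h, h'⟩

/-- Run the program `c` in place of an oracle query. -/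
def callFinder (N : ℕ) (c : Cmd) : Cmd := .seq (call N (max c.bound 2) c 1 6) (.copy 1 N)

/-- The bound `7 ≤ N` protects the arguments in registers `1` and `6` and the registers `0` and `3`
that the walk needs. Overlap with other windows would do no harm, since `call` clears its window. -/
theorem asks_callFinder {A : Dom n → PMF (Dom n)} {c : Cmd} {T : ℕ} (O : Oracle)
    (hc : c.OracleFree) {N : ℕ} (hN : 7 ≤ N)
    (h : ∀ z : Dom n, HaltsIn noOracle c (encode z) T ∧
      output noOracle c (encode z) T = (A z).map encode) :
    Asks O (callFinder N c) A (T + 2 * max c.bound 2 + 9) 0 := by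
  intro s z h1 h6
  have := (spec_call (N := N) (a := 1) (b := 6) O hc (le_max_left _ 2) (le_max_right _ _)
    (by omega) (by omega) (h z).1 s h1 h6).reindex (fun u => (u 0, u 1)) (E := A z)
    (e := encode) (encode_injective n) (by rw [← (h z).2, output, PMF.map_comp]; rfl)
  refine Spec.seq ?_
  rw [← PMF.bind_pure (A z)]
  refine this.append (K' := [_]) (T' := 1) (m' := 0) ?_
  rintro z' - s' ⟨u, hu, hw1, hw2⟩
  refine Spec.copy (Spec.nil ⟨?_, ?_, ?_⟩)
  · have := hw1 0 (by simp)
    rw [Nat.add_zero] at this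
    rw [Function.update_self, this]
    exact congrArg Prod.fst hu
  · simpa using hw2 0 (by omega)
  · simpa using hw2 3 (by omega)

end Inverter

/-! ### The analytic core: entropy deficit and the potential argument -/

section Averaging

/-! ### Expectations over finite types -/

/-- The expectation of `g` under `p`. -/
def expect {α : Type} [Fintype α] (p : PMF α) (g : α → ℝ) : ℝ := ∑ a, (p a).toReal * g a

section Expect

variable {α β : Type} [Fintype α] [Fintype β]

theorem sum_toReal_eq_one (p : PMF α) : ∑ a, (p a).toReal = 1 := by
  rw [← ENNReal.toReal_sum fun a _ => p.apply_ne_top a, ← tsum_fintype (L := .unconditional _),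
    p.tsum_coe, ENNReal.toReal_one]

theorem expect_pure (a : α) (g : α → ℝ) : expect (PMF.pure a) g = g a := by
  classical
  rw [expect, Finset.sum_eq_single a] <;> simp +contextual [PMF.pure_apply]

theorem expect_bind (p : PMF α) (q : α → PMF β) (g : β → ℝ) :
    expect (p.bind q) g = expect p fun a => expect (q a) g := by
  simp only [expect, PMF.bind_apply, tsum_fintype, Finset.mul_sum]
  rw [Finset.sum_comm]
  refine Finset.sum_congr rfl fun b _ => ?_
  rw [ENNReal.toReal_sum fun a _ => ENNReal.mul_ne_top (p.apply_ne_top _) ((q a).apply_ne_top _),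
    Finset.sum_mul]
  simp [ENNReal.toReal_mul, mul_assoc]

theorem expect_map (p : PMF α) (h : α → β) (g : β → ℝ) :
    expect (p.map h) g = expect p fun a => g (h a) := by
  rw [← PMF.bind_pure_comp, expect_bind]
  simp [expect_pure]

theorem expect_mono (p : PMF α) {g g' : α → ℝ} (h : ∀ a, g a ≤ g' a) :
    expect p g ≤ expect p g' :=
  Finset.sum_le_sum fun a _ => mul_le_mul_of_nonneg_left (h a) ENNReal.toReal_nonneg

theorem expect_const (p : PMF α) (c : ℝ) : expect p (fun _ => c) = c := by
  rw [expect, ← Finset.sum_mul, sum_toReal_eq_one, one_mul]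

theorem expect_one_sub (p : PMF α) (g : α → ℝ) : expect p (fun a => 1 - g a) = 1 - expect p g := by
  simp only [expect, mul_sub, mul_one, Finset.sum_sub_distrib, sum_toReal_eq_one]

theorem expect_uniform [Nonempty α] (g : α → ℝ) :
    expect (PMF.uniformOfFintype α) g = (∑ a, g a) / Fintype.card α := by
  simp [expect, ← Finset.mul_sum, div_eq_inv_mul]

theorem map_apply_toReal {γ : Type} (p : PMF α) (h : α → γ) (c : γ) [DecidableEq γ] :
    (p.map h c).toReal = ∑ a, if c = h a then (p a).toReal else 0 := by
  rw [PMF.map_apply, tsum_fintype, ENNReal.toReal_sum]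
  · refine Finset.sum_congr rfl fun a _ => ?_
    split_ifs <;> rfl
  · intro a _
    split_ifs
    · exact p.apply_ne_top a
    · simp

theorem map_apply_toReal_of_injective {γ : Type} (p : PMF α) {h : α → γ}
    (hh : h.Injective) (a : α) : (p.map h (h a)).toReal = (p a).toReal := by
  classical
  rw [map_apply_toReal, Finset.sum_eq_single a]
  · simp
  · intro b _ hb
    rw [if_neg fun e => hb (hh e).symm]
  · simp

end Expect

/-! ### Relative entropy and expectations -/

/-- One term of the Gibbs variational inequality against the uniform distribution on `N` points: `1
+ t ≤ exp t` at `t = s - log N - log p`, multiplied by `p`. -/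
theorem mul_le_negMulLog {p N s : ℝ} (hp : 0 ≤ p) (hN : 0 < N) :
    p * s ≤ p * Real.log N - Real.negMulLog p - p + Real.exp s / N := by
  rcases hp.eq_or_lt with rfl | hp
  · simp; positivity
  have h := Real.add_one_le_exp (s - Real.log N - Real.log p)
  rw [Real.exp_sub, Real.exp_sub, Real.exp_log hN, Real.exp_log hp, le_div_iff₀ hp] at h
  rw [Real.negMulLog]
  nlinarith

/-- The expectation of a function with values in `[0,1]` under a distribution on `S` exceeds its
average over `S` by little if the entropy of the distribution is close to `log |S|`. -/
theorem sum_mul_le_average_add {α : Type} [Fintype α] {p v : α → ℝ} {S : Finset α} {c : ℝ}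
    (hS : S.Nonempty) (hp : ∀ a, 0 ≤ p a) (hp1 : ∑ a, p a = 1) (hpS : ∀ a ∉ S, p a = 0)
    (hv : ∀ a, 0 ≤ v a) (hv1 : ∀ a, v a ≤ 1) (hc : 1 ≤ c) :
    ∑ a, p a * v a ≤ (∑ a ∈ S, v a) / S.card +
      (c * (Real.log S.card - ∑ a, Real.negMulLog (p a)) + 1 / c) := by
  have hN : (0 : ℝ) < S.card := by exact_mod_cast hS.card_pos
  have hc0 : 0 < c := by linarith
  have onS : ∀ g : α → ℝ, (∀ a ∉ S, g a = 0) → ∑ a, g a = ∑ a ∈ S, g a := fun g hg =>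
    (Finset.sum_subset (Finset.subset_univ S) fun a _ ha => hg a ha).symm
  rw [onS _ fun a ha => by rw [hpS a ha, zero_mul],
    onS _ fun a ha => by rw [hpS a ha, Real.negMulLog_zero]]
  rw [onS _ hpS] at hp1
  -- Take `s = v a / c`, which lies in `[0, 1 / c]`, and use `exp s ≤ 1 + s + s ^ 2`. Summing over
  -- `S` and multiplying by `c` gives the claim.
  have key : ∀ a ∈ S, p a * (v a / c) ≤ p a * Real.log S.card - Real.negMulLog (p a) - p a +
      (1 + v a / c + 1 / c ^ 2) / S.card := by
    intro a _
    refine (mul_le_negMulLog (hp a) hN).trans ?_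
    gcongr
    have h0 : 0 ≤ v a / c := div_nonneg (hv a) hc0.le
    have h1 : v a / c ≤ 1 / c := by gcongr; exact hv1 a
    have h2 : 1 / c ≤ 1 := by rw [div_le_one hc0]; exact hc
    have h3 := Real.abs_exp_sub_one_sub_id_le (x := v a / c) (by rw [abs_of_nonneg h0]; linarith)
    have h4 := (abs_le.1 h3).2
    have h5 : (v a / c) ^ 2 ≤ (1 / c) ^ 2 := by gcongr
    rw [one_div_pow] at h5
    linarith
  have hsum := Finset.sum_le_sum key
  simp only [← mul_div_assoc, ← Finset.sum_div, Finset.sum_add_distrib, Finset.sum_sub_distrib,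
    ← Finset.sum_mul, hp1, Finset.sum_const, nsmul_eq_mul, mul_one] at hsum
  have e : ((S.card : ℝ) + (∑ a ∈ S, v a) / c + S.card / c ^ 2) / S.card =
      1 + (∑ a ∈ S, v a) / S.card / c + 1 / c ^ 2 := by field_simp
  rw [e] at hsum
  have := mul_le_mul_of_nonneg_left hsum hc0.le
  rw [mul_div_cancel₀ _ hc0.ne'] at this
  refine this.trans (le_of_eq ?_)
  field_simp
  ring

/-! ### The walk -/

/-- A chain of sets from the whole space down to the target, and a decreasing sequence of
functions, each of which is on `S j \ S (j+1)` not much larger than the average of the preceding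
one over `S j`. -/
theorem sum_le_of_averaging {X : Type} [Fintype X] [DecidableEq X] {n : ℕ} {S : ℕ → Finset X}
    (hS : ∀ j, S (j + 1) ⊆ S j) (hS0 : S 0 = Finset.univ) (hne : ∀ j, (S j).Nonempty)
    {V : ℕ → X → ℝ} {δ : X → Fin n → ℝ} (h0 : ∀ t x, 0 ≤ V t x) (h1 : ∀ x, V 0 x ≤ 1)
    (hz : ∀ t, ∀ x ∈ S n, V t x = 0) (hmono : ∀ t x, V (t + 1) x ≤ V t x)
    (hstep : ∀ t (j : Fin n), ∀ x ∈ S j, x ∉ S (j + 1) →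
      V (t + 1) x ≤ (∑ x' ∈ S j, V t x') / (S j).card + δ x j) (T : ℕ) :
    T * ((∑ x, V T x) / Fintype.card X) ≤
      ∑ j : Fin n, ∑ x ∈ S j with x ∉ S (j + 1), (1 + T * δ x j) / (S (j + 1)).card := by
  have hN : ∀ j, (0 : ℝ) < (S j).card := fun j => by exact_mod_cast (hne j).card_pos
  have split : ∀ (g : X → ℝ) (j : ℕ),
      ∑ x ∈ S j with x ∉ S (j + 1), g x = ∑ x ∈ S j, g x - ∑ x ∈ S (j + 1), g x := by
    intro g j
    rw [← Finset.sum_filter_add_sum_filter_not (S j) (fun x => x ∈ S (j + 1))]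
    rw [Finset.filter_mem_eq_inter, Finset.inter_eq_right.2 (hS j)]
    ring
  set E : ℝ := ∑ j : Fin n, ∑ x ∈ S j with x ∉ S (j + 1), δ x j / (S (j + 1)).card with hE
  -- The weights `1 / |S (j+1)|` are chosen so that level `j` of `Φ t` equals `|S j| / |S (j+1)| * W
  -- t j - W t (j+1)`, while the step rule bounds level `j` of `Φ (t+1)`, up to the error, by `(|S
  -- j| / |S (j+1)| - 1) * W t j`.
  set Φ : ℕ → ℝ := fun t => ∑ j : Fin n, ∑ x ∈ S j with x ∉ S (j + 1),
    V t x / (S (j + 1)).card with hΦ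
  set W : ℕ → ℕ → ℝ := fun t j => (∑ x ∈ S j, V t x) / (S j).card with hW
  have hdrop : ∀ t, W t 0 ≤ Φ t - Φ (t + 1) + E := by
    intro t
    -- The last term `W t n` vanishes, as the walk has already succeeded on `S n`.
    have htel : ∑ j : Fin n, (W t j - W t (j + 1)) = W t 0 := by
      rw [Fin.sum_univ_eq_sum_range (fun j => W t j - W t (j + 1)), Finset.sum_range_sub']
      simp only [hW]
      rw [Finset.sum_eq_zero (hz t)]
      simp
    have : Φ (t + 1) ≤ ∑ j : Fin n, ∑ x ∈ S j with x ∉ S (j + 1),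
        (W t j / (S (j + 1)).card + δ x j / (S (j + 1)).card) := by
      refine Finset.sum_le_sum fun j _ => Finset.sum_le_sum fun x hx => ?_
      rw [Finset.mem_filter] at hx
      rw [← add_div]
      have := (hN (j + 1)).le
      gcongr
      exact hstep t j x hx.1 hx.2
    simp only [Finset.sum_add_distrib] at this
    have e : ∑ j : Fin n, ∑ x ∈ S j with x ∉ S (j + 1), W t j / (S (j + 1)).card =
        Φ t - W t 0 := by
      rw [← htel, hΦ, ← Finset.sum_sub_distrib]
      refine Finset.sum_congr rfl fun j _ => ?_
      rw [split, split]
      simp only [Finset.sum_const, nsmul_eq_mul, hW, ← Finset.sum_div]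
      have := (hN j).ne'
      have := (hN (j + 1)).ne'
      field_simp
      ring
    linarith
  have hsum : ∑ t ∈ Finset.range T, W t 0 ≤ Φ 0 - Φ T + T * E := by
    calc _ ≤ ∑ t ∈ Finset.range T, (Φ t - Φ (t + 1) + E) := Finset.sum_le_sum fun t _ => hdrop t
      _ = _ := by rw [Finset.sum_add_distrib, Finset.sum_range_sub']; simp
  have hanti : ∀ t, W (t + 1) 0 ≤ W t 0 := fun t => by
    have := (hN 0).le
    exact div_le_div_of_nonneg_right (Finset.sum_le_sum fun x _ => hmono t x) this
  have hlow : T * W T 0 ≤ ∑ t ∈ Finset.range T, W t 0 := by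
    have := Finset.card_nsmul_le_sum (Finset.range T) (fun t => W t 0) (W T 0)
      fun t ht => antitone_nat_of_succ_le (f := fun t => W t 0) hanti (Finset.mem_range.1 ht).le
    simpa using this
  have hΦT : 0 ≤ Φ T := Finset.sum_nonneg fun j _ => Finset.sum_nonneg fun x _ =>
    div_nonneg (h0 T x) (hN _).le
  have hΦ0 : Φ 0 ≤ ∑ j : Fin n, ∑ x ∈ S j with x ∉ S (j + 1), 1 / ((S (j + 1)).card : ℝ) :=
    Finset.sum_le_sum fun j _ => Finset.sum_le_sum fun x _ =>
      div_le_div_of_nonneg_right (h1 x) (hN _).le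
  have hW0 : W T 0 = (∑ x, V T x) / Fintype.card X := by simp [hW, hS0]
  rw [← hW0]
  simp only [add_div, Finset.sum_add_distrib, mul_div_assoc, ← Finset.mul_sum]
  linarith

/-! ### The chain of agreeing sets, averaged over the target -/

section Levels

variable {n : ℕ} (f : Bits n → Bits n)

/-- The strings whose images agree with `y` in the first `j` bits. -/
def agreeing (y : Bits n) (j : ℕ) : Finset (Bits n) :=
  Finset.univ.filter fun x => ∀ i : Fin n, i.val < j → f x i = y i

variable {f}

theorem mem_agreeing {x y : Bits n} {j : ℕ} :
    x ∈ agreeing f y j ↔ ∀ i : Fin n, i.val < j → f x i = y i := by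
  simp [agreeing]

theorem agreeing_succ_subset (y : Bits n) (j : ℕ) : agreeing f y (j + 1) ⊆ agreeing f y j :=
  fun _ hx => mem_agreeing.2 fun i hi => mem_agreeing.1 hx i (by omega)

theorem mem_agreeing_self {x y : Bits n} : x ∈ agreeing f y n ↔ f x = y := by
  rw [mem_agreeing]
  exact ⟨fun h => funext fun i => h i i.2, fun h i _ => by rw [h]⟩

theorem agreeing_nonempty (x : Bits n) (j : ℕ) : (agreeing f (f x) j).Nonempty :=
  ⟨x, mem_agreeing.2 fun _ _ => rfl⟩

theorem prefixIndex_eq {x y : Bits n} (h : f x ≠ y) {j : Fin n} (hx : x ∈ agreeing f y j)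
    (hx' : x ∉ agreeing f y (j + 1)) : prefixIndex h = j := by
  rw [mem_agreeing] at hx hx'
  refine le_antisymm (not_lt.1 fun hlt => hx' fun i hi => ?_) (not_lt.1 fun hlt => ?_)
  · exact eq_of_lt_prefixIndex h (lt_of_le_of_lt (Fin.le_def.2 (by omega)) hlt)
  · exact ne_prefixIndex h (hx _ hlt)

/-- Averaged over the target, every point is visited at every level at most once in
expectation. -/
theorem sum_levels_le {φ : Bits n → Fin n → ℝ} (hφ : ∀ x j, 0 ≤ φ x j) :
    ∑ x₀, ∑ j : Fin n, ∑ x ∈ agreeing f (f x₀) j with x ∉ agreeing f (f x₀) (j + 1),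
      φ x j / (agreeing f (f x₀) (j + 1)).card ≤ ∑ x, ∑ j, φ x j := by
  simp only [Finset.sum_filter]
  have e : ∀ (x₀ : Bits n) (j : Fin n), ∑ x ∈ agreeing f (f x₀) j,
      (if x ∉ agreeing f (f x₀) (j + 1) then φ x j / (agreeing f (f x₀) (j + 1)).card else 0) =
      ∑ x, φ x j * (if x ∈ agreeing f (f x₀) j ∧ x ∉ agreeing f (f x₀) (j + 1) then
        1 / ((agreeing f (f x₀) (j + 1)).card : ℝ) else 0) := by
    intro x₀ j
    rw [← Finset.sum_subset (Finset.subset_univ (agreeing f (f x₀) j))]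
    · refine Finset.sum_congr rfl fun x hx => ?_
      simp only [hx, true_and]
      split_ifs <;> simp [div_eq_mul_inv]
    · intro x _ hx
      simp [hx]
  simp only [e]
  rw [Finset.sum_comm]
  refine (Finset.sum_congr rfl fun j _ => Finset.sum_comm).trans_le ?_
  rw [Finset.sum_comm]
  refine Finset.sum_le_sum fun x _ => Finset.sum_le_sum fun j _ => ?_
  rw [← Finset.mul_sum]
  refine mul_le_of_le_one_right (hφ x j) ?_
  rw [← Finset.sum_filter]
  -- Every `x₀ ∈ Q` has `f x₀` equal to `f x` before bit `j` and opposite to it at bit `j`. Hence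
  -- all of `Q` agrees in the first `j + 1` bits and lies in `agreeing f (f x₀) (j + 1)`: each of
  -- the `|Q|` terms is at most `1 / |Q|`.
  set Q := Finset.univ.filter fun x₀ : Bits n =>
    x ∈ agreeing f (f x₀) j ∧ x ∉ agreeing f (f x₀) (j + 1) with hQ
  rcases Q.eq_empty_or_nonempty with h | h
  · simp [h]
  have hcard : (0 : ℝ) < Q.card := by exact_mod_cast h.card_pos
  have hsub : ∀ x₀ ∈ Q, 1 / ((agreeing f (f x₀) (j + 1)).card : ℝ) ≤ 1 / Q.card := by
    intro x₀ hx₀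
    refine one_div_le_one_div_of_le hcard ?_
    refine Nat.cast_le.2 (Finset.card_le_card fun x₁ hx₁ => ?_)
    have hneq : ∀ x₀ ∈ Q, (∀ i < j, f x i = f x₀ i) ∧ f x j ≠ f x₀ j := by
      intro x₀ hx₀
      simp only [hQ, Finset.mem_filter, Finset.mem_univ, true_and, mem_agreeing] at hx₀
      refine ⟨hx₀.1, fun hj => hx₀.2 fun i hi => ?_⟩
      rcases (Nat.lt_succ_iff_lt_or_eq.1 hi) with hi | hi
      · exact hx₀.1 i hi
      · rw [Fin.ext hi, hj]
    have a := hneq x₀ hx₀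
    have b := hneq x₁ hx₁
    rw [mem_agreeing]
    intro i hi
    rcases (Nat.lt_succ_iff_lt_or_eq.1 hi) with hi | hi
    · rw [← a.1 i hi, b.1 i hi]
    · rw [Fin.ext hi]
      have := a.2
      have := b.2
      revert this ‹f x j ≠ f x₀ j›
      cases f x j <;> cases f x₀ j <;> cases f x₁ j <;> simp
  calc _ ≤ ∑ x₀ ∈ Q, 1 / (Q.card : ℝ) := Finset.sum_le_sum hsub
    _ = 1 := by simp [hcard.ne']
    _ ≤ 1 := le_rfl

end Levels

end Averaging

/-! ### Failure probability and entropies of the inverter's walk -/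

section Success

variable {n : ℕ}

/-! ### The success probability of the inverter -/

open Classical in
/-- The probability that `t` steps from `x` do not lead to a preimage of `y`. -/
def failure (f : Bits n → Bits n) (A : Dom n → PMF (Dom n)) (y : Bits n) (t : ℕ) (x : Bits n) :
    ℝ :=
  expect (walk f A y t x) fun x' => if f x' = y then 0 else 1

section Failure

variable {f : Bits n → Bits n} {A : Dom n → PMF (Dom n)} {x y : Bits n}

theorem failure_zero : failure f A y 0 x = if f x = y then 0 else 1 := by
  rw [failure, walk, expect_pure]

theorem failure_succ (t : ℕ) :
    failure f A y (t + 1) x = expect (move f A y x) (failure f A y t) := by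
  rw [failure, walk, expect_bind]
  rfl

theorem failure_nonneg (t : ℕ) (x : Bits n) : 0 ≤ failure f A y t x :=
  Finset.sum_nonneg fun _ _ => mul_nonneg ENNReal.toReal_nonneg (by dsimp only; split_ifs <;> simp)

theorem failure_le_one (t : ℕ) (x : Bits n) : failure f A y t x ≤ 1 := by
  rw [← expect_const (walk f A y t x) 1]
  exact expect_mono _ fun _ => by split_ifs <;> simp

theorem failure_of_eq (h : f x = y) (t : ℕ) : failure f A y t x = 0 := by
  induction t with
  | zero => rw [failure_zero, if_pos h]
  | succ t ih => rw [failure_succ, move, dif_pos h, expect_pure, ih]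

theorem failure_succ_of_ne (h : f x ≠ y) (t : ℕ) : failure f A y (t + 1) x =
    expect (A (x, prefixIndex h)) fun z => failure f A y t z.1 := by
  rw [failure_succ, move, dif_neg h, expect_map]

/-- Preimages are absorbing, which settles the first step; later steps follow since taking
expectations is monotone. -/
theorem failure_antitone (t : ℕ) (x : Bits n) :
    failure f A y (t + 1) x ≤ failure f A y t x := by
  induction t generalizing x with
  | zero =>
    by_cases h : f x = y
    · rw [failure_of_eq h, failure_of_eq h]
    · rw [failure_zero, if_neg h]
      exact failure_le_one _ _
  | succ t ih =>
    rw [failure_succ, failure_succ]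
    exact expect_mono _ ih

end Failure

/-- The length of the prefix reveals the index, so a fibre of `trim` is an agreeing set at one fixed
level. -/
theorem trim_eq_iff {f : ∀ n, Bits n → Bits n} {z z' : Dom n} :
    trim f n z' = trim f n z ↔ z'.2 = z.2 ∧ z'.1 ∈ agreeing (f n) (f n z.1) z.2 := by
  constructor
  · intro h
    have h2 := congrArg List.length h
    simp only [trim, List.length_take, List.length_ofFn] at h2
    have h3 : z'.2 = z.2 := Fin.ext (by omega)
    refine ⟨h3, mem_agreeing.2 fun i hi => ?_⟩
    have h4 := congrArg (fun l => l[i.val]?) h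
    simpa [trim, h3, List.getElem?_take, hi] using h4
  · rintro ⟨h, h'⟩
    rw [mem_agreeing] at h'
    rw [trim, trim, h]
    refine List.ext_getElem (by simp) fun i hi _ => ?_
    simp only [List.length_take, List.length_ofFn, lt_min_iff] at hi
    simpa using h' ⟨i, hi.2⟩ hi.1

/-- The deficit, in nats, of the entropy of `A (x, j)` against its largest possible value. -/
def deficit (f : ∀ n, Bits n → Bits n) (A : Dom n → PMF (Dom n)) (z : Dom n) : ℝ :=
  Real.log (agreeing (f n) (f n z.1) z.2).card - ∑ z', Real.negMulLog (A z z').toReal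

/-- Collision finding confines `A z` to the fibre of `z`, a copy of an agreeing set at level `z.2`,
so the variational bound applies with that fibre as `S`. -/
theorem expect_le_average_add {f : ∀ n, Bits n → Bits n} {A : Dom n → PMF (Dom n)}
    (hA : IsCollisionFinder (trim f n) A) (z : Dom n) {v : Bits n → ℝ} (hv : ∀ x, 0 ≤ v x)
    (hv1 : ∀ x, v x ≤ 1) {c : ℝ} (hc : 1 ≤ c) :
    expect (A z) (fun z' => v z'.1) ≤ (∑ x ∈ agreeing (f n) (f n z.1) z.2, v x) /
      (agreeing (f n) (f n z.1) z.2).card + (c * deficit f A z + 1 / c) := by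
  have h := sum_mul_le_average_add (p := fun z' => (A z z').toReal) (v := fun z' => v z'.1)
    (S := (agreeing (f n) (f n z.1) z.2).map ⟨fun x => (x, z.2), fun _ _ h => congrArg Prod.fst h⟩)
    ((agreeing_nonempty z.1 z.2).map) (fun _ => ENNReal.toReal_nonneg) (sum_toReal_eq_one _)
    (fun z' hz' => ?_) (fun _ => hv _) (fun _ => hv1 _) hc
  · rw [Finset.card_map, Finset.sum_map] at h
    exact h
  · rw [ENNReal.toReal_eq_zero_iff]
    left
    by_contra hne
    have := trim_eq_iff.1 (hA z z' hne)
    refine hz' (Finset.mem_map.2 ⟨z'.1, this.2, ?_⟩)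
    exact Prod.ext rfl this.1.symm

theorem sum_failure_le {f : ∀ n, Bits n → Bits n} {A : Dom n → PMF (Dom n)}
    (hA : IsCollisionFinder (trim f n) A) {c : ℝ} (hc : 1 ≤ c) (T : ℕ) :
    T * ∑ x₀, (∑ x, failure (f n) A (f n x₀) T x) / Fintype.card (Bits n) ≤
      ∑ x, ∑ j : Fin n, (1 + T * (c * deficit f A (x, j) + 1 / c)) := by
  -- The variational bound for the zero function says exactly that the error term is nonnegative.
  have hδ : ∀ x (j : Fin n), 0 ≤ c * deficit f A (x, j) + 1 / c := fun x j => by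
    have := expect_le_average_add hA (x, j) (v := fun _ => 0) (fun _ => le_rfl) (fun _ => by simp) hc
    simpa [expect] using this
  refine le_trans ?_ (sum_levels_le (f := f n)
    (fun x j => add_nonneg zero_le_one (mul_nonneg T.cast_nonneg (hδ x j))))
  rw [Finset.mul_sum]
  refine Finset.sum_le_sum fun x₀ _ => ?_
  refine sum_le_of_averaging (S := agreeing (f n) (f n x₀))
    (V := failure (f n) A (f n x₀)) (agreeing_succ_subset _) (by simp [agreeing])
    (agreeing_nonempty x₀) failure_nonneg (failure_le_one 0)
    (fun t x hx => failure_of_eq (mem_agreeing_self.1 hx) t) failure_antitone ?_ T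
  intro t j x hx hx'
  have hne : f n x ≠ f n x₀ := fun e => hx' (mem_agreeing.2 fun _ _ => by rw [e])
  have hj := prefixIndex_eq hne hx hx'
  -- Since `x` lies at level `j` of the chain of `f x₀`, its own fibre at that level is the set `S
  -- j` of this chain.
  have hS : agreeing (f n) (f n x) j = agreeing (f n) (f n x₀) j := by
    ext x'
    rw [mem_agreeing] at hx
    simp only [mem_agreeing]
    exact forall₂_congr fun i hi => by rw [hx i hi]
  rw [failure_succ_of_ne hne, hj]
  have := expect_le_average_add hA (x, j) (failure_nonneg (f := f n) (A := A) (y := f n x₀) t)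
    (failure_le_one t) hc
  rwa [hS] at this

theorem inversionProb_inverse (f : Bits n → Bits n) (A : Dom n → PMF (Dom n)) :
    inversionProb f (fun y => (inverse f A y).map List.ofFn) =
      1 - (∑ x₀, (∑ x, failure f A (f x₀) (8 * n) x) / Fintype.card (Bits n)) /
        Fintype.card (Bits n) := by
  classical
  have e : ((PMF.uniformOfFintype (Bits n)).bind fun x =>
      ((inverse f A (f x)).map List.ofFn).map fun w => (x, w)) =
      ((PMF.uniformOfFintype (Bits n)).bind fun x => (inverse f A (f x)).map fun x' => (x, x')).map
        fun q => (q.1, List.ofFn q.2) := by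
    rw [PMF.map_bind]
    simp only [PMF.map_comp]
    rfl
  rw [inversionProb, e, PMF.toOuterMeasure_map_apply, PMF.toOuterMeasure_apply_fintype,
    ENNReal.toReal_sum]
  · have e2 : ∀ (P : PMF (Bits n × Bits n)),
        ∑ q, (((fun q : Bits n × Bits n => (q.1, List.ofFn q.2)) ⁻¹'
          {q | ∃ x' : Bits n, q.2 = List.ofFn x' ∧ f x' = f q.1}).indicator P q).toReal =
        expect P fun q => 1 - if f q.2 = f q.1 then 0 else 1 := by
      intro P
      refine Finset.sum_congr rfl fun q _ => ?_
      by_cases h : f q.2 = f q.1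
      · rw [Set.indicator_of_mem]
        · simp [h]
        · exact ⟨q.2, rfl, h⟩
      · rw [Set.indicator_of_notMem]
        · simp [h]
        · rintro ⟨x', h1, h2⟩
          rw [← List.ofFn_injective h1] at h2
          exact h h2
    rw [e2, expect_one_sub, expect_bind]
    simp only [expect_map, inverse, expect_bind, expect_uniform]
    rfl
  · intro q _
    refine ne_top_of_le_ne_top (PMF.apply_ne_top _ q) (Set.indicator_le_self _ _ _)

/-! ### Entropies -/

/-- Given its image, `Z` is uniform on a fibre, whose size is that of the agreeing set; the factor
`Real.log 2` converts bits to nats. -/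
theorem realEntropy_mul_log [NeZero n] (f : ∀ n, Bits n → Bits n) :
    realEntropy (trim f n) * Real.log 2 =
      (∑ z : Dom n, Real.log (agreeing (f n) (f n z.1) z.2).card) / Fintype.card (Dom n) := by
  classical
  have hD : (Fintype.card (Dom n) : ℝ) ≠ 0 := by simp [NeZero.ne n]
  rw [realEntropy, condEntropy, Finset.sum_mul, Finset.sum_div]
  refine Finset.sum_congr rfl fun z _ => ?_
  have h1 := map_apply_toReal_of_injective (PMF.uniformOfFintype (Dom n))
    (h := fun z => (id z, trim f n z)) (fun _ _ h => congrArg Prod.fst h) z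
  have h2 : ((PMF.uniformOfFintype (Dom n)).map (trim f n) (trim f n z)).toReal =
      (agreeing (f n) (f n z.1) z.2).card / Fintype.card (Dom n) := by
    rw [map_apply_toReal, ← Finset.sum_filter]
    simp only [PMF.uniformOfFintype_apply, Finset.sum_const, nsmul_eq_mul, ENNReal.toReal_inv,
      ENNReal.toReal_natCast, ← div_eq_mul_inv]
    congr 2
    rw [← Finset.card_map ⟨fun x : Bits n => (x, z.2), fun _ _ h => congrArg Prod.fst h⟩]
    congr 1
    ext z'
    simp only [Finset.mem_filter, Finset.mem_univ, true_and, eq_comm (a := trim f n z),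
      trim_eq_iff, Finset.mem_map]
    constructor
    · rintro ⟨h, h'⟩
      exact ⟨z'.1, h', Prod.ext rfl h.symm⟩
    · rintro ⟨x, hx, rfl⟩
      exact ⟨rfl, hx⟩
  rw [h1, h2]
  simp only [PMF.uniformOfFintype_apply, ENNReal.toReal_inv, ENNReal.toReal_natCast]
  rw [div_inv_eq_mul, div_mul_cancel₀ _ hD, mul_assoc, Real.logb,
    div_mul_cancel₀ _ (Real.log_pos one_lt_two).ne', inv_mul_eq_div]

theorem outputEntropy_mul_log [NeZero n] (A : Dom n → PMF (Dom n)) :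
    outputEntropy A * Real.log 2 =
      (∑ z, ∑ z', Real.negMulLog (A z z').toReal) / Fintype.card (Dom n) := by
  classical
  have hD : (Fintype.card (Dom n) : ℝ) ≠ 0 := by simp [NeZero.ne n]
  rw [outputEntropy, condEntropy, Finset.sum_mul, Fintype.sum_prod_type, Finset.sum_div]
  refine Finset.sum_congr rfl fun z _ => ?_
  rw [Finset.sum_div]
  refine Finset.sum_congr rfl fun z' _ => ?_
  set P := (PMF.uniformOfFintype (Dom n)).bind fun z => (A z).map fun z' => (z, z') with hP
  have h1 : P.map Prod.fst = PMF.uniformOfFintype (Dom n) := by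
    rw [hP, PMF.map_bind]
    simp only [PMF.map_comp]
    conv_rhs => rw [← PMF.bind_pure (PMF.uniformOfFintype (Dom n))]
    congr 1
    funext z
    exact PMF.map_const _ _
  have h2 := map_apply_toReal_of_injective P (h := fun ω => (ω.2, ω.1))
    (fun _ _ h => Prod.ext (congrArg Prod.snd h) (congrArg Prod.fst h)) (z, z')
  have h3 : (P (z, z')).toReal = (A z z').toReal / Fintype.card (Dom n) := by
    have : P (z, z') = PMF.uniformOfFintype (Dom n) z * A z z' := by
      rw [hP, PMF.bind_apply, tsum_eq_single z]
      · rw [PMF.map_apply, tsum_eq_single z']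
        · simp
        · intro b hb
          rw [if_neg]
          simpa using hb.symm
      · intro b hb
        rw [PMF.map_apply, ENNReal.tsum_eq_zero.2, mul_zero]
        intro c
        rw [if_neg]
        simp [hb.symm]
    rw [this, ENNReal.toReal_mul, PMF.uniformOfFintype_apply, ENNReal.toReal_inv,
      ENNReal.toReal_natCast, inv_mul_eq_div]
  rw [h1, h2, h3]
  simp only [PMF.uniformOfFintype_apply, ENNReal.toReal_inv, ENNReal.toReal_natCast]
  rw [div_div_eq_mul_div, inv_mul_cancel₀ hD, mul_assoc, Real.logb,
    div_mul_cancel₀ _ (Real.log_pos one_lt_two).ne', one_div, Real.log_inv, Real.negMulLog]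
  ring

/-- The inverter succeeds if the collision finder has almost the largest possible entropy. -/
theorem one_fourth_le_inversionProb [NeZero n] {f : ∀ n, Bits n → Bits n}
    {A : Dom n → PMF (Dom n)} (hA : IsCollisionFinder (trim f n) A)
    (h : realEntropy (trim f n) - 1 / (64 * (n : ℝ) ^ 2) ≤ outputEntropy A) :
    1 / 4 ≤ inversionProb (f n) fun y => (inverse (f n) A y).map List.ofFn := by
  have hn : (1 : ℝ) ≤ n := by exact_mod_cast NeZero.one_le
  have hB : (0 : ℝ) < Fintype.card (Bits n) := by exact_mod_cast Fintype.card_pos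
  have hD : (Fintype.card (Dom n) : ℝ) = Fintype.card (Bits n) * n := by simp
  have hD0 : (0 : ℝ) < Fintype.card (Dom n) := by rw [hD]; positivity
  -- Passing from bits to nats only shrinks the allowed deficit.
  have hlog : Real.log 2 ≤ 1 := by linarith [Real.log_two_lt_d9]
  have hdef : ∑ z, deficit f A z ≤ Fintype.card (Dom n) * (1 / (64 * (n : ℝ) ^ 2)) := by
    have h1 := mul_le_mul_of_nonneg_right h (Real.log_pos one_lt_two).le
    rw [sub_mul, realEntropy_mul_log, outputEntropy_mul_log, sub_le_comm, ← sub_div,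
      ← Finset.sum_sub_distrib] at h1
    have h2 : 1 / (64 * (n : ℝ) ^ 2) * Real.log 2 ≤ 1 / (64 * (n : ℝ) ^ 2) :=
      mul_le_of_le_one_right (by positivity) hlog
    rw [mul_comm]
    exact (div_le_iff₀ hD0).1 (h1.trans h2)
  -- With `T = c = 8 n` the summand becomes `2 + 64 n² * deficit`: one unit for the potential, one
  -- for `T / c`, and the deficit scaled to match the gap `1 / (64 n²)`.
  have hmain := sum_failure_le hA (c := 8 * n) (by linarith) (8 * n)
  rw [← Fintype.sum_prod_type (fun z : Dom n =>
    1 + ((8 * n : ℕ) : ℝ) * (8 * n * deficit f A z + 1 / (8 * n)))] at hmain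
  have e : ∀ z : Dom n, 1 + ((8 * n : ℕ) : ℝ) * (8 * n * deficit f A z + 1 / (8 * n)) =
      2 + 64 * (n : ℝ) ^ 2 * deficit f A z := fun z => by
    push_cast
    field_simp
    ring
  simp only [e, Finset.sum_add_distrib, ← Finset.mul_sum, Finset.sum_const, nsmul_eq_mul,
    Finset.card_univ] at hmain
  have h3 : 64 * (n : ℝ) ^ 2 * ∑ z, deficit f A z ≤ Fintype.card (Dom n) := by
    refine (mul_le_mul_of_nonneg_left hdef (by positivity)).trans (le_of_eq ?_)
    field_simp
  rw [inversionProb_inverse]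
  set F := ∑ x₀, (∑ x, failure (f n) A (f n x₀) (8 * n) x) / Fintype.card (Bits n) with hF
  -- The total is at most three units per pair `(x, j)`, to be divided by `T = 8 n`.
  have h4 : F / Fintype.card (Bits n) ≤ 3 / 8 := by
    rw [div_le_iff₀ hB]
    rw [hD] at hmain h3
    push_cast at hmain
    have : (n : ℝ) * F ≤ n * (3 / 8 * Fintype.card (Bits n)) := by linarith
    exact le_of_mul_le_mul_left this (by linarith)
  linarith

/-- Used for both statements: only `ask` and its costs `Ta` and `m` differ. -/
theorem inverter_correct {f : ∀ n, Bits n → Bits n} {A : Dom n → PMF (Dom n)} {O : Oracle}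
    {c ask : Cmd} {Tf Ta m t : ℕ} (hc : c.OracleFree) (hask : Asks O ask A Ta m)
    (hf : ∀ x : Bits n, HaltsIn noOracle c (encodeBits x) Tf ∧
      (output noOracle c (encodeBits x) Tf).map Prod.fst = PMF.pure (List.ofFn (f n x)))
    (ht : 8 * n * (Tf + 2 * max c.bound 2 + Ta + 8 * n + 33) + 24 * n + 20 ≤ t) (y : Bits n) :
    HaltsIn O (inverter c ask) (encodeBits y) t ∧
      QueriesAtMost O (inverter c ask) (encodeBits y) t (8 * n * m) ∧
      (output O (inverter c ask) (encodeBits y) t).map Prod.fst =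
        (inverse (f n) A y).map List.ofFn :=
  have h := spec_inverter hc hask hf y
  ⟨h.haltsIn ht, h.queriesAtMost ht, h.output_map_fst ht fun _ _ e => e⟩

end Success

end InaccessibleEntropy

end

/-! ### The theorem -/

open InaccessibleEntropy in
theorem mainTheorem4 (f : ∀ n, Bits n → Bits n) :
    -- a one-way function yields a function whose inverse has inaccessible Shannon entropy
    (IsOneWay f →
      AccessibleEntropyAtMost (trim f) fun n => realEntropy (trim f n) - 1 / (64 * (n : ℝ) ^ 2)) ∧
    -- the reduction: one polynomial-time oracle inverter works with every collision finder
    (PolyTimeComputable f →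
      ∃ (inv : Cmd) (p : Polynomial ℕ), ∀ (n : ℕ) [NeZero n] (A : Dom n → PMF (Dom n)),
        IsCollisionFinder (trim f n) A →
          (∀ y : Bits n, HaltsIn (oracleOf A) inv (encodeBits y) (p.eval n) ∧
            QueriesAtMost (oracleOf A) inv (encodeBits y) (p.eval n) (8 * n)) ∧
          (realEntropy (trim f n) - 1 / (64 * (n : ℝ) ^ 2) ≤ outputEntropy A →
            1 / 4 ≤ inversionProb (f n) fun y =>
              (output (oracleOf A) inv (encodeBits y) (p.eval n)).map Prod.fst)) := by
  constructor
  · rintro ⟨⟨c, p, hc, -, hf⟩, hinv⟩ A ⟨a, q, ha, hA⟩ hcoll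
    have key : ∀ n (y : Bits n), _ := fun n y =>
      inverter_correct (A := A n) hc
        (asks_callFinder noOracle ha (N := 9 + max c.bound 2) (by omega) (hA n)) (hf n)
        (t := (8 * Polynomial.X * (p + 2 * Polynomial.C (max c.bound 2) +
          (q + 2 * Polynomial.C (max a.bound 2) + 9) + 8 * Polynomial.X + 33) +
          24 * Polynomial.X + 20 : Polynomial ℕ).eval n) (by simp) y
    have hdecay := hinv _ _
      (inverter_oracleFree hc (by simp [callFinder, Cmd.OracleFree, call_oracleFree ha]))
      fun n y => (key n y).1
    -- Superpolynomial decay is needed only with exponent `0`: the success probability tends to `0`,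
    -- so it eventually drops below `1/4`.
    have hlt := (hdecay 0).eventually_lt_const (show (0 : ℝ) < 1 / 4 by norm_num)
    filter_upwards [hlt] with n hn _
    by_contra! hcon
    have h := one_fourth_le_inversionProb (hcoll n) hcon.le
    simp only [pow_zero, one_mul, (key n _).2.2] at hn
    exact absurd hn (not_lt.2 h)
  · rintro ⟨c, p, hc, -, hf⟩
    refine ⟨inverter c (.query 1 6), 8 * Polynomial.X * (p + 2 * Polynomial.C (max c.bound 2) +
      1 + 8 * Polynomial.X + 33) + 24 * Polynomial.X + 20, fun n _ A hA => ?_⟩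
    have key := inverter_correct hc (asks_query A) (hf n)
      (t := (8 * Polynomial.X * (p + 2 * Polynomial.C (max c.bound 2) +
        1 + 8 * Polynomial.X + 33) + 24 * Polynomial.X + 20 : Polynomial ℕ).eval n) (by simp)
    refine ⟨fun y => ⟨(key y).1, by simpa only [mul_one] using (key y).2.1⟩, fun h => ?_⟩
    simp only [(key _).2.2]
    exact one_fourth_le_inversionProb hA h
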